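/- Let $\Omega=(0,1)^2$ and let $\kappa:\Omega\to\mathbb R$ be measurable with $0<\kappa_{\min}\le\kappa(x)\le\kappa_{\max}<\infty$ for all $x\in\Omega$. For $u,v\in H_0^1(\Omega)$ and $f\in L^2(\Omega)$ put $a(u,v)=\int_\Omega\kappa\,\nabla u\cdot\nabla v\,dx$, $\ell(v)=\int_\Omega f v\,dx$ and $\|u\|_{H_0^1}=\|\nabla u\|_{L^2(\Omega)}$. Let $u\in H_0^1(\Omega)$ be the weak solution of $-\nabla\cdot(\kappa\nabla u)=f$, i.e. $a(u,v)=\ell(v)$ for all $v\in H_0^1(\Omega)$. Let $\varphi_{mn}(x,y)=\sin(m\pi x)\sin(n\pi y)$ and $\lambda_{m,n}=\pi^2(m^2+n^2)$ for $m,n\ge1$ be the Dirichlet eigenfunctions and eigenvalues of $-\Delta$ on $\Omega$, and let $V_M=\operatorname{span}\{\varphi_{mn}:1\le m,n\le M\}$. For $h>0$ let $V_h\subset H_0^1(\Omega)$ be a finite-dimensional subspace and $\Pi_h$ a linear operator into $V_h$; put $V_M^h=\Pi_hV_M$. The Galerkin solution $u_h\in V_h$ and the reduced solution $u_{RD}\in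 V_M^h$ are defined by $a(u_h,v)=\ell(v)$ for all $v\in V_h$ and $a(u_{RD},v)=\ell(v)$ for all $v\in V_M^h$. Fix a constant $C_0>0$. Assume that the discretization satisfies $\|u-u_h\|_{H_0^1}\le C_0\,h\,\|u\|_{H^2(\Omega)}$ for every $f\in L^2(\Omega)$ whose weak solution $u$ lies in $H^2(\Omega)$, and that $\Pi_h$ either is the energy projection onto $V_h$ (that is, $a(\Pi_hw,v)=a(w,v)$ for all $w\in H_0^1(\Omega)$, $v\in V_h$) or has the first-order approximation property $\|w-\Pi_hw\|_{H_0^1}\le C_0\,h\,\|w\|_{H^2(\Omega)}$ for all $w\in V_M$. Then there is a constant $C>0$, depending only on $\kappa$ and $C_0$ (in particular independent of $h$, $M$, $V_h$, $\Pi_h$, $f$ and $u$), such that for all $h>0$, all integers $M\ge2$, and all $V_h$, $\Pi_h$, $f$ as above with $u\in H^2(\Omega)\cap H_0^1(\Omega)$, $$\|u_h-u_{RD}\|_{H_0^1}\le C\Bigl(h+\frac{\sqrt{\log M}}{M}\Bigr)\|u\|_{H^2(\Omega)}.$$ If, moreover, the boundary value problem is $H^2$-regular, i.e. for every right-hand side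 in $L^2(\Omega)$ the weak solution lies in $H^2(\Omega)$, then (with the same $C$) $$\|u_h-u_{RD}\|_{L^2}\le C\Bigl(h^2+\frac{1}{\sqrt{\lambda_{M+1,M+1}}}\,\frac{\sqrt{\log M}}{M}\Bigr)\|u\|_{H^2(\Omega)}.$$ -/

import Mathlib

open MeasureTheory Filter
open scoped Topology ENNReal ContDiff

noncomputable section

namespace LowMode

/-- The open unit square `Ω = (0,1)²`. -/
def Ω : Set (Fin 2 → ℝ) := {x | ∀ i, x i ∈ Set.Ioo (0 : ℝ) 1}

/-- Lebesgue measure on the unit square. -/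
abbrev μΩ : Measure (Fin 2 → ℝ) := volume.restrict Ω

/-- Real `L²(Ω)`. -/
abbrev L2 : Type := Lp ℝ 2 μΩ

/-- Test functions: elements of `C_c^∞(Ω)`, as functions on the plane. -/
structure IsTest (φ : (Fin 2 → ℝ) → ℝ) : Prop where
  smooth : ContDiff ℝ ∞ φ
  compact : HasCompactSupport φ
  subset : tsupport φ ⊆ Ω

/-- The classical partial derivative `∂φ/∂xᵢ`. -/
def pderiv (i : Fin 2) (φ : (Fin 2 → ℝ) → ℝ) (x : Fin 2 → ℝ) : ℝ :=
  fderiv ℝ φ x (Pi.single i 1)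

/-- `g ∈ L²(Ω)` is the weak partial derivative `∂u/∂xᵢ` of `u ∈ L²(Ω)`. -/
def HasWeakPartial (i : Fin 2) (u g : L2) : Prop :=
  ∀ φ, IsTest φ → ∫ x in Ω, u x * pderiv i φ x = - ∫ x in Ω, g x * φ x

/-- The test function `φ` converges to `u` together with its gradient to `g`, in `L²(Ω)`. -/
def TestApprox (u : L2) (g : Fin 2 → L2) (φ : ℕ → (Fin 2 → ℝ) → ℝ) : Prop :=
  (∀ n, IsTest (φ n)) ∧
  Tendsto (fun n => eLpNorm (fun x => u x - φ n x) 2 μΩ) atTop (𝓝 0) ∧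
  ∀ i, Tendsto (fun n => eLpNorm (fun x => g i x - pderiv i (φ n) x) 2 μΩ) atTop (𝓝 0)

/-- `u ∈ H₀¹(Ω)`: `u ∈ L²(Ω)` has weak first derivatives in `L²(Ω)`, and it is the limit of
functions of `C_c^∞(Ω)` in the `H¹` norm. -/
def MemH10 (u : L2) : Prop :=
  ∃ g : Fin 2 → L2, (∀ i, HasWeakPartial i u (g i)) ∧ ∃ φ, TestApprox u g φ

theorem IsTest.memLp {φ : (Fin 2 → ℝ) → ℝ} (h : IsTest φ) : MemLp φ 2 μΩ :=
  (h.smooth.continuous.memLp_of_hasCompactSupport h.compact)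

theorem IsTest.continuous_pderiv {φ : (Fin 2 → ℝ) → ℝ} (h : IsTest φ) (i : Fin 2) :
    Continuous (pderiv i φ) :=
  (h.smooth.continuous_fderiv (by simp)).clm_apply continuous_const

theorem IsTest.memLp_pderiv {φ : (Fin 2 → ℝ) → ℝ} (h : IsTest φ) (i : Fin 2) :
    MemLp (pderiv i φ) 2 μΩ :=
  (h.continuous_pderiv i).memLp_of_hasCompactSupport (h.compact.fderiv_apply (𝕜 := ℝ) _)

theorem IsTest.zero : IsTest (fun _ => 0) where
  smooth := contDiff_const
  compact := HasCompactSupport.zero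
  subset := by
    have : tsupport (fun _ : Fin 2 → ℝ => (0 : ℝ)) = ∅ := by
      rw [tsupport_eq_empty_iff]; rfl
    rw [this]; exact Set.empty_subset _

theorem IsTest.add {φ ψ : (Fin 2 → ℝ) → ℝ} (hφ : IsTest φ) (hψ : IsTest ψ) :
    IsTest (fun x => φ x + ψ x) where
  smooth := hφ.smooth.add hψ.smooth
  compact := hφ.compact.add hψ.compact
  subset := (tsupport_add φ ψ).trans (Set.union_subset hφ.subset hψ.subset)

theorem IsTest.const_mul {φ : (Fin 2 → ℝ) → ℝ} (hφ : IsTest φ) (c : ℝ) :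
    IsTest (fun x => c * φ x) where
  smooth := contDiff_const.mul hφ.smooth
  compact := hφ.compact.mul_left
  subset := (tsupport_mul_subset_right (f := fun _ => c) (g := φ)).trans hφ.subset

theorem pderiv_add {φ ψ : (Fin 2 → ℝ) → ℝ} (hφ : IsTest φ) (hψ : IsTest ψ) (i : Fin 2)
    (x : Fin 2 → ℝ) :
    pderiv i (fun y => φ y + ψ y) x = pderiv i φ x + pderiv i ψ x := by
  have h1 := (hφ.smooth.differentiable (by simp)) x
  have h2 := (hψ.smooth.differentiable (by simp)) x
  simp only [pderiv]
  rw [fderiv_fun_add h1 h2]; rfl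

theorem pderiv_const_mul {φ : (Fin 2 → ℝ) → ℝ} (hφ : IsTest φ) (c : ℝ) (i : Fin 2)
    (x : Fin 2 → ℝ) : pderiv i (fun y => c * φ y) x = c * pderiv i φ x := by
  have h1 := (hφ.smooth.differentiable (by simp)) x
  simp only [pderiv]
  rw [fderiv_const_mul h1]; rfl

theorem HasWeakPartial.zero (i : Fin 2) : HasWeakPartial i 0 0 := by
  intro φ _
  have h : ∀ ψ : (Fin 2 → ℝ) → ℝ, ∫ x in Ω, (0 : L2) x * ψ x = 0 := by
    intro ψ
    refine integral_eq_zero_of_ae ?_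
    filter_upwards [Lp.coeFn_zero ℝ 2 μΩ] with x hx
    rw [hx]; simp
  rw [h, h, neg_zero]

theorem HasWeakPartial.add {i : Fin 2} {u v g k : L2} (hu : HasWeakPartial i u g)
    (hv : HasWeakPartial i v k) : HasWeakPartial i (u + v) (g + k) := by
  intro φ hφ
  have key : ∀ (a b : L2) (ψ : (Fin 2 → ℝ) → ℝ), MemLp ψ 2 μΩ →
      ∫ x in Ω, (a + b : L2) x * ψ x = (∫ x in Ω, a x * ψ x) + ∫ x in Ω, b x * ψ x := by
    intro a b ψ hψ
    refine Eq.trans (integral_congr_ae ?_)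
      (integral_add ((Lp.memLp a).integrable_mul hψ) ((Lp.memLp b).integrable_mul hψ))
    filter_upwards [Lp.coeFn_add a b] with x hx
    simp only [hx, Pi.add_apply, Pi.mul_apply]; ring
  rw [key _ _ _ (hφ.memLp_pderiv i), key _ _ _ hφ.memLp, hu φ hφ, hv φ hφ]
  ring

theorem HasWeakPartial.smul {i : Fin 2} {u g : L2} (c : ℝ) (hu : HasWeakPartial i u g) :
    HasWeakPartial i (c • u) (c • g) := by
  intro φ hφ
  have key : ∀ (a : L2) (ψ : (Fin 2 → ℝ) → ℝ),
      ∫ x in Ω, (c • a : L2) x * ψ x = c * ∫ x in Ω, a x * ψ x := by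
    intro a ψ
    rw [← integral_const_mul]
    refine integral_congr_ae ?_
    filter_upwards [Lp.coeFn_smul c a] with x hx
    simp [hx, mul_assoc]
  rw [key, key, hu φ hφ]
  ring

/-- Weak partial derivatives are unique, so `weakPartial` below does not depend on a choice. -/
theorem HasWeakPartial.unique {i : Fin 2} {u g k : L2} (hg : HasWeakPartial i u g)
    (hk : HasWeakPartial i u k) : g = k := by
  have hΩ : IsOpen Ω := by
    have : Ω = Set.univ.pi (fun _ : Fin 2 => Set.Ioo (0 : ℝ) 1) := by
      ext x; simp [Ω]
    rw [this]
    exact isOpen_set_pi Set.finite_univ fun _ _ => isOpen_Ioo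
  have hd := hg.add (hk.smul (-1))
  have h0 : ∀ᵐ x ∂(volume : Measure (Fin 2 → ℝ)), x ∈ Ω → (g - k : L2) x = 0 := by
    refine hΩ.ae_eq_zero_of_integral_contDiff_smul_eq_zero ?_ ?_
    · have : LocallyIntegrable ((g - k : L2)) μΩ :=
        (Lp.memLp (g - k)).locallyIntegrable (by norm_num)
      refine LocallyIntegrableOn.mono_set ?_ subset_rfl
      exact locallyIntegrableOn_of_locallyIntegrable_restrict this
    · intro φ h1 h2 h3
      have hφ : IsTest φ := ⟨h1, h2, h3⟩
      have e : ∫ x in Ω, (g - k : L2) x * φ x = 0 := by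
        have e1 := hd φ hφ
        have e2 : u + (-1 : ℝ) • u = 0 := by simp
        have e3 : g + (-1 : ℝ) • k = g - k := by simp [sub_eq_add_neg]
        rw [e2, e3] at e1
        have e4 := HasWeakPartial.zero i φ hφ
        rw [e4] at e1
        have e5 : ∫ x in Ω, (0 : L2) x * φ x = 0 := by
          refine integral_eq_zero_of_ae ?_
          filter_upwards [Lp.coeFn_zero ℝ 2 μΩ] with x hx
          rw [hx]; simp
        rw [e5] at e1
        linarith
      have e' : ∫ x in Ω, φ x • (g - k : L2) x = 0 := by
        simpa [mul_comm] using e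
      rw [← e', eq_comm]
      refine setIntegral_eq_integral_of_forall_compl_eq_zero ?_
      intro x hx
      have : φ x = 0 := image_eq_zero_of_notMem_tsupport fun h => hx (h3 h)
      simp [this]
  have h1 : (g - k : L2) = 0 := by
    rw [Lp.eq_zero_iff_ae_eq_zero]
    exact (ae_restrict_iff' hΩ.measurableSet).2 h0
  exact sub_eq_zero.1 h1

/-- The space `H₀¹(Ω)`, as a subspace of `L²(Ω)`. -/
def H10 : Submodule ℝ L2 where
  carrier := {u | MemH10 u}
  zero_mem' := by
    refine ⟨fun _ => 0, fun i => HasWeakPartial.zero i, fun _ _ => 0, fun _ => IsTest.zero, ?_, ?_⟩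
    · have : eLpNorm (fun x => (0 : L2) x - 0) 2 μΩ = 0 := by
        rw [eLpNorm_congr_ae (g := fun _ => (0 : ℝ))]
        · simp
        · filter_upwards [Lp.coeFn_zero ℝ 2 μΩ] with x hx
          rw [hx]; simp
      simp only [this, tendsto_const_nhds]
    · intro i
      have : eLpNorm (fun x => (0 : L2) x - pderiv i (fun _ => (0 : ℝ)) x) 2 μΩ = 0 := by
        rw [eLpNorm_congr_ae (g := fun _ => (0 : ℝ))]
        · simp
        · filter_upwards [Lp.coeFn_zero ℝ 2 μΩ] with x hx
          rw [hx]; simp [pderiv]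
      simp only [this, tendsto_const_nhds]
  add_mem' := by
    rintro u v ⟨g, hg, φ, hφ, hφ0, hφ1⟩ ⟨k, hk, ψ, hψ, hψ0, hψ1⟩
    have key : ∀ (a b : L2) (α β : ℕ → (Fin 2 → ℝ) → ℝ),
        (∀ n, MemLp (α n) 2 μΩ) → (∀ n, MemLp (β n) 2 μΩ) →
        Tendsto (fun n => eLpNorm (fun x => a x - α n x) 2 μΩ) atTop (𝓝 0) →
        Tendsto (fun n => eLpNorm (fun x => b x - β n x) 2 μΩ) atTop (𝓝 0) →
        Tendsto (fun n => eLpNorm (fun x => (a + b : L2) x - (α n x + β n x)) 2 μΩ)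
          atTop (𝓝 0) := by
      intro a b α β hα hβ ha hb
      have hsum := ha.add hb
      rw [add_zero] at hsum
      refine tendsto_of_tendsto_of_tendsto_of_le_of_le tendsto_const_nhds hsum
        (fun _ => zero_le) fun n => ?_
      have : (fun x => (a + b : L2) x - (α n x + β n x)) =ᵐ[μΩ]
          (fun x => a x - α n x) + (fun x => b x - β n x) := by
        filter_upwards [Lp.coeFn_add a b] with x hx
        simp only [hx, Pi.add_apply]; ring
      dsimp only
      rw [eLpNorm_congr_ae this]
      exact eLpNorm_add_le ((Lp.memLp a).sub (hα n)).1 ((Lp.memLp b).sub (hβ n)).1 (by norm_num)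
    refine ⟨fun i => g i + k i, fun i => (hg i).add (hk i), fun n x => φ n x + ψ n x,
      fun n => (hφ n).add (hψ n), ?_, fun i => ?_⟩
    · exact key u v φ ψ (fun n => (hφ n).memLp) (fun n => (hψ n).memLp) hφ0 hψ0
    · simp only [pderiv_add (hφ _) (hψ _)]
      exact key (g i) (k i) _ _ (fun n => (hφ n).memLp_pderiv i) (fun n => (hψ n).memLp_pderiv i)
        (hφ1 i) (hψ1 i)
  smul_mem' := by
    rintro c u ⟨g, hg, φ, hφ, hφ0, hφ1⟩
    have key : ∀ (a : L2) (α : ℕ → (Fin 2 → ℝ) → ℝ),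
        Tendsto (fun n => eLpNorm (fun x => a x - α n x) 2 μΩ) atTop (𝓝 0) →
        Tendsto (fun n => eLpNorm (fun x => (c • a : L2) x - c * α n x) 2 μΩ)
          atTop (𝓝 0) := by
      intro a α ha
      have h := ENNReal.Tendsto.const_mul (a := ‖c‖ₑ) ha (Or.inr enorm_ne_top)
      rw [mul_zero] at h
      refine h.congr fun n => ?_
      have : (fun x => (c • a : L2) x - c * α n x) =ᵐ[μΩ] c • (fun x => a x - α n x) := by
        filter_upwards [Lp.coeFn_smul c a] with x hx
        simp only [hx, Pi.smul_apply, smul_eq_mul]; ring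
      rw [eLpNorm_congr_ae this, eLpNorm_const_smul]
    refine ⟨fun i => c • g i, fun i => (hg i).smul c, fun n x => c * φ n x,
      fun n => (hφ n).const_mul c, key u φ hφ0, fun i => ?_⟩
    simp only [pderiv_const_mul (hφ _)]
    exact key (g i) _ (hφ1 i)

open Classical in
/-- The weak partial derivative `∂u/∂xᵢ` of `u ∈ L²(Ω)`; zero if there is none in `L²(Ω)`. -/
def weakPartial (i : Fin 2) (u : L2) : L2 :=
  if h : ∃ g, HasWeakPartial i u g then h.choose else 0

/-- `u ∈ H²(Ω)`: all weak derivatives of order one and two exist in `L²(Ω)`. -/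
def MemH2 (u : L2) : Prop :=
  (∀ i, ∃ g, HasWeakPartial i u g) ∧ ∀ i j, ∃ g, HasWeakPartial j (weakPartial i u) g

/-- The `H²(Ω)` norm. -/
def normH2 (u : L2) : ℝ :=
  √(‖u‖ ^ 2 + ∑ i, ‖weakPartial i u‖ ^ 2 + ∑ i, ∑ j, ‖weakPartial j (weakPartial i u)‖ ^ 2)

/-- The `H₀¹(Ω)` norm `‖u‖ = (∫_Ω |∇u|²)^{1/2}`. -/
def normH10 (u : H10) : ℝ :=
  √(∑ i, ‖weakPartial i (u : L2)‖ ^ 2)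

/-- Coefficients with `0 < κ_min ≤ κ ≤ κ_max` on `Ω`. -/
structure IsElliptic (κ : (Fin 2 → ℝ) → ℝ) (κmin κmax : ℝ) : Prop where
  meas : AEStronglyMeasurable κ μΩ
  pos : 0 < κmin
  lower : ∀ x ∈ Ω, κmin ≤ κ x
  upper : ∀ x ∈ Ω, κ x ≤ κmax

/-- `a(u,v) = ∫_Ω κ ∇u · ∇v`. -/
def aForm (κ : (Fin 2 → ℝ) → ℝ) (u v : H10) : ℝ :=
  ∫ x in Ω, κ x * ∑ i, weakPartial i (u : L2) x * weakPartial i (v : L2) x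

/-- `ℓ(v) = ∫_Ω f v`. -/
def ell (f : L2) (v : H10) : ℝ := ∫ x in Ω, f x * (v : L2) x

/-- `u ∈ S` and `a(u,v) = ℓ(v)` for all `v ∈ S`. -/
def IsGalerkin (κ : (Fin 2 → ℝ) → ℝ) (f : L2) (S : Submodule ℝ H10) (u : H10) : Prop :=
  u ∈ S ∧ ∀ v ∈ S, aForm κ u v = ell f v

/-- `u` is the weak solution of `-∇·(κ∇u) = f` in `Ω`, `u = 0` on `∂Ω`. -/
def IsWeakSolution (κ : (Fin 2 → ℝ) → ℝ) (f : L2) (u : H10) : Prop :=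
  ∀ v, aForm κ u v = ell f v

/-- `H²` regularity of the boundary value problem: for every `f ∈ L²(Ω)` the weak solution
belongs to `H²(Ω)`. -/
def H2Regular (κ : (Fin 2 → ℝ) → ℝ) : Prop :=
  ∀ f u, IsWeakSolution κ f u → MemH2 u

/-- The finite element error bound `‖u - u_h‖_{H₀¹} ≤ C h ‖u‖_{H²}`, for the discretization by
`Vh` of the problem with coefficient `κ`. -/
def FEErrorBound (κ : (Fin 2 → ℝ) → ℝ) (Vh : Submodule ℝ H10) (h C : ℝ) : Prop :=
  ∀ f u uh, IsWeakSolution κ f u → MemH2 u → IsGalerkin κ f Vh uh →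
    normH10 (u - uh) ≤ C * h * normH2 u

theorem memLp_sine (m n : ℕ) :
    MemLp (fun x : Fin 2 → ℝ => Real.sin (m * Real.pi * x 0) * Real.sin (n * Real.pi * x 1))
      2 μΩ := by
  have hfin : IsFiniteMeasure μΩ := by
    refine ⟨?_⟩
    rw [Measure.restrict_apply_univ]
    have hsub : Ω ⊆ Set.Icc (0 : Fin 2 → ℝ) 1 := fun x hx =>
      ⟨fun i => (hx i).1.le, fun i => (hx i).2.le⟩
    exact (measure_mono hsub).trans_lt isCompact_Icc.measure_lt_top
  refine MemLp.of_bound (Continuous.aestronglyMeasurable (by fun_prop)) 1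
    (Eventually.of_forall fun x => ?_)
  rw [norm_mul]
  exact mul_le_one₀ (Real.abs_sin_le_one _) (norm_nonneg _) (Real.abs_sin_le_one _)

/-- The Dirichlet eigenfunction `φ_{mn}(x,y) = sin(mπx) sin(nπy)` of `-Δ` on `Ω`. -/
def mode (m n : ℕ) : L2 := (memLp_sine m n).toLp _

/-- The Dirichlet eigenvalue `λ_{mn} = π²(m² + n²)`. -/
def eigval (m n : ℕ) : ℝ := Real.pi ^ 2 * ((m : ℝ) ^ 2 + (n : ℝ) ^ 2)

/-- The low-mode space `V_M = span {φ_{mn} : 1 ≤ m, n ≤ M}`, as a subspace of `H₀¹(Ω)` (which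
contains all `φ_{mn}`, so that intersecting the span with `H₀¹(Ω)` removes nothing). -/
def VM (M : ℕ) : Submodule ℝ H10 :=
  (Submodule.span ℝ {φ : L2 | ∃ m n : ℕ, 1 ≤ m ∧ m ≤ M ∧ 1 ≤ n ∧ n ≤ M ∧ φ = mode m n}).comap
    H10.subtype

/-- The discrete low-mode space `V_M^h = Π_h V_M ⊆ V_h`. -/
def VMh (M : ℕ) (Vh : Submodule ℝ H10) (P : H10 →ₗ[ℝ] Vh) : Submodule ℝ H10 :=
  (VM M).map (Vh.subtype ∘ₗ P)

/-- `P` is the energy projection onto `V_h`: `a(P w, v) = a(w, v)` for all `v ∈ V_h`. -/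
def IsEnergyProjection (κ : (Fin 2 → ℝ) → ℝ) (Vh : Submodule ℝ H10) (P : H10 →ₗ[ℝ] Vh) : Prop :=
  ∀ w, ∀ v ∈ Vh, aForm κ (P w : H10) v = aForm κ w v

/-- The first order approximation property of a finite element projection or interpolation
operator `P`, on the low-mode space: `‖w - P w‖_{H₀¹} ≤ C h ‖w‖_{H²}` for `w ∈ V_M`. -/
def ApproxProperty (M : ℕ) (Vh : Submodule ℝ H10) (P : H10 →ₗ[ℝ] Vh) (h C : ℝ) : Prop :=
  ∀ w ∈ VM M, normH10 (w - (P w : H10)) ≤ C * h * normH2 w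

end LowMode

end

noncomputable section

namespace LowMode

/-! The sine products form an orthonormal basis of `L2` (up to scaling), lie in `H10` and
diagonalize the Laplacian. For `u` in H² ∩ H¹₀, two integrations by parts without boundary terms
show that the sine coefficients of Δu are `-lam k` times those of `u` (`inner_T_lap`). Omitted modes
have `lam k ≥ M²`, so the truncated series has L² error at most ‖Δu‖/M². The gradient of the
truncation error e satisfies ‖∇e‖² = -(Δu, e), hence ‖∇e‖ ≤ ‖Δu‖/M (`normH10_sub_trunc_le`). The
truncation is also bounded in H² by Δu (`normH2_trunc_le`), which makes the approximation property
of the projection usable on it.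

Applying the projection to the truncated series gives an element of `VMh` within a multiple of (h +
1/M)‖u‖ in H² of the discrete solution (`exists_mem_VMh_near`). Céa's lemma inside `Vh` then bounds
the reduced solution's H¹ error. The logarithm is not needed: for M ≥ 2 the rate 1/M is dominated by
√(log M)/M.

For the L² bound, Aubin-Nitsche duality is run with the dual Galerkin solution in `Vh`, approximated
from `VMh` by the same lemma. This gives (h + 1/M)² once the dual solution is bounded in H² by its
datum. Regularity is assumed only as membership in H²; the closed graph theorem turns it into an
estimate with a constant depending on κ alone (`exists_bound_normH2`).

Two facts about the sines need work: membership in `H10`, by smooth cutoffs near the boundary, and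
completeness in `L2`, by Stone-Weierstrass. -/

/-! ### Continuous functions as elements of L²(Ω). -/

theorem Ω_eq_pi : Ω = Set.univ.pi (fun _ : Fin 2 => Set.Ioo (0 : ℝ) 1) := by
  ext x; simp [Ω]

theorem isOpen_Ω : IsOpen Ω := by
  rw [Ω_eq_pi]
  exact isOpen_set_pi Set.finite_univ fun _ _ => isOpen_Ioo

theorem Ω_subset_Icc : Ω ⊆ Set.Icc (0 : Fin 2 → ℝ) 1 := fun _ hx =>
  ⟨fun i => (hx i).1.le, fun i => (hx i).2.le⟩

instance isFiniteMeasure_μΩ : IsFiniteMeasure μΩ := by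
  refine ⟨?_⟩
  rw [Measure.restrict_apply_univ]
  exact (measure_mono Ω_subset_Icc).trans_lt isCompact_Icc.measure_lt_top

theorem ae_mem_Ω : ∀ᵐ x ∂μΩ, x ∈ Ω := ae_restrict_mem isOpen_Ω.measurableSet

theorem memLp_of_continuous {f : (Fin 2 → ℝ) → ℝ} (hf : Continuous f) : MemLp f 2 μΩ := by
  obtain ⟨C, hC⟩ := (isCompact_Icc (a := (0 : Fin 2 → ℝ)) (b := 1)).exists_bound_of_continuousOn
    hf.continuousOn
  refine MemLp.of_bound hf.aestronglyMeasurable C ?_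
  filter_upwards [ae_mem_Ω] with x hx using hC x (Ω_subset_Icc hx)

/-- The class in `L²(Ω)` of a continuous function on the plane. -/
def toL2 : C(Fin 2 → ℝ, ℝ) →ₗ[ℝ] L2 where
  toFun f := (memLp_of_continuous f.continuous).toLp f
  map_add' f g := MemLp.toLp_add (memLp_of_continuous f.continuous)
    (memLp_of_continuous g.continuous)
  map_smul' c f := MemLp.toLp_const_smul c (memLp_of_continuous f.continuous)

theorem coeFn_toL2 (f : C(Fin 2 → ℝ, ℝ)) : toL2 f =ᵐ[μΩ] f :=
  MemLp.coeFn_toLp (memLp_of_continuous f.continuous)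

theorem L2_inner_eq (f g : L2) : inner ℝ f g = ∫ x in Ω, f x * g x := by
  rw [L2.inner_def]
  refine integral_congr_ae (Eventually.of_forall fun x => ?_)
  simp [mul_comm]

theorem inner_toL2 (f : L2) (g : C(Fin 2 → ℝ, ℝ)) :
    inner ℝ f (toL2 g) = ∫ x in Ω, f x * g x := by
  rw [L2_inner_eq]
  refine integral_congr_ae ?_
  filter_upwards [coeFn_toL2 g] with x hx
  rw [hx]

theorem inner_toL2_toL2 (f g : C(Fin 2 → ℝ, ℝ)) :
    inner ℝ (toL2 f) (toL2 g) = ∫ x in Ω, f x * g x := by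
  rw [inner_toL2]
  refine integral_congr_ae ?_
  filter_upwards [coeFn_toL2 f] with x hx
  rw [hx]

theorem norm_toL2_le {f : C(Fin 2 → ℝ, ℝ)} {C : ℝ} (hC : 0 ≤ C) (h : ∀ x ∈ Ω, |f x| ≤ C) :
    ‖toL2 f‖ ≤ measureUnivNNReal μΩ ^ ((2 : ℝ≥0∞).toReal⁻¹) * C := by
  refine Lp.norm_le_of_ae_bound hC ?_
  filter_upwards [coeFn_toL2 f, ae_mem_Ω] with x h1 h2
  rw [h1]; exact h x h2

theorem norm_toL2_mul_le {f g : C(Fin 2 → ℝ, ℝ)} (h : ∀ x ∈ Ω, |f x| ≤ 1) :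
    ‖toL2 (f * g)‖ ≤ ‖toL2 g‖ := by
  refine Lp.norm_le_norm_of_ae_le ?_
  filter_upwards [coeFn_toL2 (f * g), coeFn_toL2 g, ae_mem_Ω] with x h1 h2 h3
  rw [h1, h2, ContinuousMap.mul_apply, norm_mul]
  exact mul_le_of_le_one_left (norm_nonneg _) (h x h3)

/-- Dominated convergence: on a set of finite measure, a uniform bound and pointwise convergence
suffice. -/
theorem tendsto_toL2 {F : ℕ → C(Fin 2 → ℝ, ℝ)} {f : C(Fin 2 → ℝ, ℝ)} {C : ℝ}
    (hC : ∀ n, ∀ x ∈ Ω, |F n x| ≤ C) (hlim : ∀ x ∈ Ω, Tendsto (fun n => F n x) atTop (𝓝 (f x))) :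
    Tendsto (fun n => toL2 (F n)) atTop (𝓝 (toL2 f)) := by
  rw [tendsto_iff_norm_sub_tendsto_zero]
  have h2 : Tendsto (fun n => ‖toL2 (F n) - toL2 f‖ ^ 2) atTop (𝓝 0) := by
    have e : ∀ n, ‖toL2 (F n) - toL2 f‖ ^ 2 = ∫ x in Ω, (F n x - f x) * (F n x - f x) := by
      intro n
      rw [← map_sub, ← real_inner_self_eq_norm_sq, inner_toL2_toL2]
      simp
    simp only [e]
    have h0 : (0 : ℝ) = ∫ _ in Ω, (0 : ℝ) := by simp
    rw [h0]
    refine tendsto_integral_of_dominated_convergence (fun _ => (C + C) * (C + C))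
      (fun n => (by fun_prop : Continuous _).aestronglyMeasurable) (integrable_const _)
      (fun n => ?_) ?_
    · filter_upwards [ae_mem_Ω] with x hx
      have hf : |f x| ≤ C := le_of_tendsto (hlim x hx).abs (Eventually.of_forall fun n => hC n x hx)
      have h1 : |F n x - f x| ≤ C + C := (abs_sub _ _).trans (add_le_add (hC n x hx) hf)
      rw [Real.norm_eq_abs, abs_mul]
      exact mul_le_mul h1 h1 (abs_nonneg _) ((abs_nonneg _).trans h1)
    · filter_upwards [ae_mem_Ω] with x hx
      have h1 : Tendsto (fun n => F n x - f x) atTop (𝓝 0) := by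
        simpa using (hlim x hx).sub_const (f x)
      simpa using h1.mul h1
  have h3 := h2.sqrt
  simpa [Real.sqrt_sq (norm_nonneg _)] using h3

/-! ### Weak derivatives: smooth functions and limits. -/

/-- A test function as a continuous map. -/
def IsTest.toC {φ : (Fin 2 → ℝ) → ℝ} (h : IsTest φ) : C(Fin 2 → ℝ, ℝ) := ⟨φ, h.smooth.continuous⟩

/-- The partial derivative of a `C¹` function as a continuous map. -/
def pderivC (i : Fin 2) {f : (Fin 2 → ℝ) → ℝ} (h : ContDiff ℝ 1 f) : C(Fin 2 → ℝ, ℝ) :=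
  ⟨pderiv i f, (h.continuous_fderiv (by simp)).clm_apply continuous_const⟩

theorem IsTest.contDiff_one {φ : (Fin 2 → ℝ) → ℝ} (h : IsTest φ) : ContDiff ℝ 1 φ :=
  h.smooth.of_le (by simp)

/-- The class in `L²(Ω)` of a test function. -/
def IsTest.cls {φ : (Fin 2 → ℝ) → ℝ} (h : IsTest φ) : L2 := toL2 h.toC

/-- The class in `L²(Ω)` of a partial derivative of a test function. -/
def IsTest.dcls {φ : (Fin 2 → ℝ) → ℝ} (h : IsTest φ) (i : Fin 2) : L2 :=
  toL2 (pderivC i h.contDiff_one)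

theorem hasWeakPartial_iff {i : Fin 2} {u g : L2} :
    HasWeakPartial i u g ↔
      ∀ φ, ∀ h : IsTest φ, inner ℝ u (h.dcls i) = - inner ℝ g h.cls := by
  refine forall_congr' fun φ => forall_congr' fun h => ?_
  rw [IsTest.dcls, IsTest.cls, inner_toL2, inner_toL2]
  rfl

/-- Since `φ` has compact support in `Ω`, both integrals extend to the whole plane, where
integration by parts has no boundary term. Nothing is asked of `ψ` at the boundary. -/
theorem setIntegral_mul_pderiv {ψ φ : (Fin 2 → ℝ) → ℝ} (hψ : ContDiff ℝ 1 ψ) (hφ : IsTest φ)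
    (i : Fin 2) : ∫ x in Ω, ψ x * pderiv i φ x = - ∫ x in Ω, pderiv i ψ x * φ x := by
  have hs : ∀ x, x ∉ Ω → x ∉ tsupport φ := fun x hx h => hx (hφ.subset h)
  have hd : ∀ x, x ∉ Ω → pderiv i φ x = 0 := by
    intro x hx
    have : fderiv ℝ φ x = 0 :=
      image_eq_zero_of_notMem_tsupport fun h => hs x hx (tsupport_fderiv_subset ℝ h)
    simp [pderiv, this]
  rw [setIntegral_eq_integral_of_forall_compl_eq_zero fun x hx => by rw [hd x hx, mul_zero],
    setIntegral_eq_integral_of_forall_compl_eq_zero fun x hx => by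
      rw [image_eq_zero_of_notMem_tsupport (hs x hx), mul_zero]]
  have hcψ : Continuous (pderiv i ψ) := (pderivC i hψ).continuous
  have hcφ := hφ.smooth.continuous
  have hcd := hφ.continuous_pderiv i
  refine integral_mul_fderiv_eq_neg_fderiv_mul_of_integrable (v := Pi.single i 1) ?_ ?_ ?_
    (fun x _ => hψ.differentiable (by simp) x) (fun x _ => hφ.smooth.differentiable (by simp) x)
  · exact (hcψ.mul hcφ).integrable_of_hasCompactSupport hφ.compact.mul_left
  · exact (hψ.continuous.mul hcd).integrable_of_hasCompactSupport
      (hφ.compact.fderiv_apply (𝕜 := ℝ) _).mul_left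
  · exact (hψ.continuous.mul hcφ).integrable_of_hasCompactSupport hφ.compact.mul_left

theorem hasWeakPartial_toL2 {f : C(Fin 2 → ℝ, ℝ)} (hf : ContDiff ℝ 1 f) (i : Fin 2) :
    HasWeakPartial i (toL2 f) (toL2 (pderivC i hf)) := by
  rw [hasWeakPartial_iff]
  intro φ h
  rw [IsTest.dcls, IsTest.cls, inner_toL2_toL2, inner_toL2_toL2]
  exact setIntegral_mul_pderiv hf h i

theorem IsTest.hasWeakPartial {φ : (Fin 2 → ℝ) → ℝ} (h : IsTest φ) (i : Fin 2) :
    HasWeakPartial i h.cls (h.dcls i) :=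
  hasWeakPartial_toL2 (f := h.toC) h.contDiff_one i

theorem HasWeakPartial.weakPartial_eq {i : Fin 2} {u g : L2} (h : HasWeakPartial i u g) :
    weakPartial i u = g := by
  have hex : ∃ g, HasWeakPartial i u g := ⟨g, h⟩
  rw [weakPartial, dif_pos hex]
  exact hex.choose_spec.unique h

theorem hasWeakPartial_weakPartial {i : Fin 2} {u : L2} (h : ∃ g, HasWeakPartial i u g) :
    HasWeakPartial i u (weakPartial i u) := by
  obtain ⟨g, hg⟩ := h
  rwa [hg.weakPartial_eq]

/-- Each instance of the weak identity is an equality of inner products with fixed vectors, so it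
passes to L² limits. -/
theorem HasWeakPartial.of_tendsto {i : Fin 2} {u g : ℕ → L2} {u' g' : L2}
    (h : ∀ n, HasWeakPartial i (u n) (g n)) (hu : Tendsto u atTop (𝓝 u'))
    (hg : Tendsto g atTop (𝓝 g')) : HasWeakPartial i u' g' := by
  simp only [hasWeakPartial_iff] at h ⊢
  intro φ hφ
  refine tendsto_nhds_unique (hu.inner tendsto_const_nhds) ?_
  simp only [h _ φ hφ]
  exact (hg.inner tendsto_const_nhds).neg

theorem HasWeakPartial.sum {ι : Type*} (s : Finset ι) {i : Fin 2} {u g : ι → L2}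
    (h : ∀ k, HasWeakPartial i (u k) (g k)) :
    HasWeakPartial i (∑ k ∈ s, u k) (∑ k ∈ s, g k) := by
  classical
  induction s using Finset.induction_on with
  | empty => simpa using HasWeakPartial.zero i
  | insert k s hk ih => rw [Finset.sum_insert hk, Finset.sum_insert hk]; exact (h k).add ih

/-! ### H¹₀ as the closure of the graph of the gradient, and the Poincaré inequality. -/

/-- The pairs `(φ, ∇φ)` for test functions `φ`. -/
def testGraph : Set (L2 × (Fin 2 → L2)) :=
  {p | ∃ φ, ∃ h : IsTest φ, p = (h.cls, fun i => h.dcls i)}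

theorem eLpNorm_sub_eq_norm (u : L2) (f : C(Fin 2 → ℝ, ℝ)) :
    eLpNorm (fun x => u x - f x) 2 μΩ = ENNReal.ofReal ‖u - toL2 f‖ := by
  rw [Lp.norm_def, ENNReal.ofReal_toReal (Lp.eLpNorm_ne_top _)]
  refine eLpNorm_congr_ae ?_
  filter_upwards [Lp.coeFn_sub u (toL2 f), coeFn_toL2 f] with x h1 h2
  rw [h1, Pi.sub_apply, h2]

theorem tendsto_eLpNorm_sub_iff {u : L2} {f : ℕ → C(Fin 2 → ℝ, ℝ)} :
    Tendsto (fun n => eLpNorm (fun x => u x - f n x) 2 μΩ) atTop (𝓝 0) ↔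
      Tendsto (fun n => toL2 (f n)) atTop (𝓝 u) := by
  simp only [eLpNorm_sub_eq_norm, ← dist_eq_norm, ← edist_dist]
  rw [tendsto_iff_edist_tendsto_0]
  simp only [edist_comm]

theorem hasWeakPartial_of_mem_closure {u : L2} {g : Fin 2 → L2} (h : (u, g) ∈ closure testGraph)
    (i : Fin 2) : HasWeakPartial i u (g i) := by
  obtain ⟨p, hp, hlim⟩ := mem_closure_iff_seq_limit.1 h
  have hlim' := (Prod.tendsto_iff _ _).1 hlim
  refine HasWeakPartial.of_tendsto (u := fun n => (p n).1) (g := fun n => (p n).2 i) ?_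
    hlim'.1 ((tendsto_pi_nhds.1 hlim'.2) i)
  intro n
  obtain ⟨φ, hφ, e⟩ := hp n
  rw [e]
  exact hφ.hasWeakPartial i

theorem memH10_of_mem_closure {u : L2} {g : Fin 2 → L2} (h : (u, g) ∈ closure testGraph) :
    u ∈ H10 := by
  refine ⟨g, hasWeakPartial_of_mem_closure h, ?_⟩
  obtain ⟨p, hp, hlim⟩ := mem_closure_iff_seq_limit.1 h
  choose φ hφ e using hp
  have hlim' := (Prod.tendsto_iff _ _).1 hlim
  refine ⟨φ, hφ, ?_, fun i => ?_⟩
  · refine (tendsto_eLpNorm_sub_iff (f := fun n => (hφ n).toC)).2 ?_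
    simpa [e] using! hlim'.1
  · refine (tendsto_eLpNorm_sub_iff (f := fun n => pderivC i (hφ n).contDiff_one)).2 ?_
    have := (tendsto_pi_nhds.1 hlim'.2) i
    simpa [e] using! this

theorem mem_closure_of_memH10 {u : L2} (h : u ∈ H10) :
    (u, fun i => weakPartial i u) ∈ closure testGraph := by
  obtain ⟨g, hg, φ, hφ, h0, h1⟩ := h
  have e : (fun i => weakPartial i u) = g := funext fun i => (hg i).weakPartial_eq
  rw [e, mem_closure_iff_seq_limit]
  refine ⟨fun n => ((hφ n).cls, fun i => (hφ n).dcls i), fun n => ⟨φ n, hφ n, rfl⟩, ?_⟩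
  refine Tendsto.prodMk_nhds ?_ (tendsto_pi_nhds.2 fun i => ?_)
  · exact (tendsto_eLpNorm_sub_iff (f := fun n => (hφ n).toC)).1 h0
  · exact (tendsto_eLpNorm_sub_iff (f := fun n => pderivC i (hφ n).contDiff_one)).1 (h1 i)

theorem hasWeakPartial_of_memH10 {u : L2} (h : u ∈ H10) (i : Fin 2) :
    HasWeakPartial i u (weakPartial i u) :=
  hasWeakPartial_of_mem_closure (mem_closure_of_memH10 h) i

/-- Integration by parts against elements of `H₀¹(Ω)`. -/
theorem inner_weakPartial_right {v w g : L2} (hv : v ∈ H10) {i : Fin 2}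
    (hw : HasWeakPartial i w g) : inner ℝ w (weakPartial i v) = - inner ℝ g v := by
  have hcl : IsClosed {p : L2 × (Fin 2 → L2) | inner ℝ w (p.2 i) = - inner ℝ g p.1} :=
    isClosed_eq (by fun_prop) (by fun_prop)
  refine closure_minimal ?_ hcl (mem_closure_of_memH10 hv)
  rintro p ⟨φ, hφ, rfl⟩
  exact hasWeakPartial_iff.1 hw φ hφ

/-- Testing ∂₀(x₀φ) = φ + x₀∂₀φ against `φ` gives ‖φ‖² = -2∫x₀ φ ∂₀φ, and |x₀| ≤ 1 on the square. -/
theorem IsTest.poincare {φ : (Fin 2 → ℝ) → ℝ} (h : IsTest φ) : ‖h.cls‖ ≤ 2 * ‖h.dcls 0‖ := by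
  let X : C(Fin 2 → ℝ, ℝ) := ⟨fun x => x 0, by fun_prop⟩
  have hX : ContDiff ℝ 1 (fun x : Fin 2 → ℝ => x 0) := by fun_prop
  have hc : ContDiff ℝ 1 (X * h.toC : C(Fin 2 → ℝ, ℝ)) := hX.mul h.contDiff_one
  have e : pderivC 0 hc = h.toC + X * pderivC 0 h.contDiff_one := by
    ext x
    change fderiv ℝ (fun x => x 0 * φ x) x (Pi.single 0 1) = φ x + x 0 * pderiv 0 φ x
    rw [fderiv_fun_mul (hX.differentiable (by simp) x) (h.contDiff_one.differentiable (by simp) x)]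
    have : fderiv ℝ (fun x : Fin 2 → ℝ => x 0) x (Pi.single 0 1) = 1 := by
      rw [fderiv_apply (hasFDerivAt_id x).differentiableAt]
      simp
    simp [this, pderiv]
    ring
  have h1 := hasWeakPartial_iff.1 (hasWeakPartial_toL2 hc 0) φ h
  have hX1 : ∀ x ∈ Ω, |X x| ≤ 1 := fun x hx => abs_le.2 ⟨by
    have := (hx 0).1; change -1 ≤ x 0; linarith, (hx 0).2.le⟩
  have e2 : inner ℝ (toL2 (X * h.toC)) (h.dcls 0) =
      inner ℝ h.cls (toL2 (X * pderivC 0 h.contDiff_one)) := by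
    rw [IsTest.dcls, IsTest.cls, inner_toL2_toL2, inner_toL2_toL2]
    refine integral_congr_ae (Eventually.of_forall fun x => ?_)
    simp only [ContinuousMap.mul_apply]; ring
  rw [e, map_add, inner_add_left, e2, real_inner_comm h.cls (toL2 (X * _))] at h1
  change _ = -(inner ℝ h.cls h.cls + _) at h1
  rw [real_inner_self_eq_norm_sq] at h1
  have h3 : ‖toL2 (X * pderivC 0 h.contDiff_one)‖ ≤ ‖h.dcls 0‖ := norm_toL2_mul_le hX1
  generalize toL2 (X * pderivC 0 h.contDiff_one) = z at h1 h3
  have h2 := abs_real_inner_le_norm h.cls z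
  have h4 := neg_abs_le (inner ℝ h.cls z)
  have h5 : ‖h.cls‖ ^ 2 ≤ 2 * (‖h.cls‖ * ‖h.dcls 0‖) := by
    have := mul_le_mul_of_nonneg_left h3 (norm_nonneg h.cls)
    linarith
  by_contra! hlt
  have hpos : 0 < ‖h.cls‖ := lt_of_le_of_lt (by positivity) hlt
  nlinarith

theorem poincare {u : L2} (h : u ∈ H10) : ‖u‖ ≤ 2 * ‖weakPartial 0 u‖ := by
  obtain ⟨p, hp, hlim⟩ := mem_closure_iff_seq_limit.1 (mem_closure_of_memH10 h)
  have hlim' := (Prod.tendsto_iff _ _).1 hlim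
  refine le_of_tendsto_of_tendsto' hlim'.1.norm
    (((tendsto_pi_nhds.1 hlim'.2) 0).norm.const_mul 2) fun n => ?_
  obtain ⟨φ, hφ, e⟩ := hp n
  rw [e]
  exact hφ.poincare

/-- The weak gradient on `H₀¹(Ω)`. -/
def grad : H10 →ₗ[ℝ] PiLp 2 (fun _ : Fin 2 => L2) where
  toFun u := WithLp.toLp 2 fun i => weakPartial i (u : L2)
  map_add' u v := by
    ext1 i
    exact ((hasWeakPartial_of_memH10 u.2 i).add (hasWeakPartial_of_memH10 v.2 i)).weakPartial_eq
  map_smul' c u := by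
    ext1 i
    exact ((hasWeakPartial_of_memH10 u.2 i).smul c).weakPartial_eq

theorem norm_grad (u : H10) : ‖grad u‖ = normH10 u := by
  rw [PiLp.norm_eq_of_L2]; rfl

theorem norm_le_normH10 (u : H10) : ‖(u : L2)‖ ≤ 2 * normH10 u := by
  rw [← norm_grad]
  exact (poincare u.2).trans (mul_le_mul_of_nonneg_left (PiLp.norm_apply_le (grad u) 0) two_pos.le)

/-- By Poincaré, convergent gradients force the functions themselves to be Cauchy, and the limiting
pair stays in the closed graph. This lets Lax-Milgram run on the space of gradients without a
separate Hilbert space structure on `H10`. -/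
theorem isComplete_range_grad : IsComplete (Set.range grad) := by
  refine IsClosed.isComplete ?_
  refine IsSeqClosed.isClosed fun p g hp hlim => ?_
  choose u hu using hp
  have hc : CauchySeq fun n => (u n : L2) := by
    have h1 := hlim.cauchySeq
    rw [Metric.cauchySeq_iff'] at h1 ⊢
    intro ε hε
    obtain ⟨N, hN⟩ := h1 (ε / 2) (by positivity)
    refine ⟨N, fun n hn => ?_⟩
    have h2 := hN n hn
    rw [← hu, ← hu, dist_eq_norm, ← map_sub, norm_grad] at h2
    have h3 := norm_le_normH10 (u n - u N)
    rw [dist_eq_norm]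
    push_cast at h3
    linarith
  obtain ⟨v, hv⟩ := cauchySeq_tendsto_of_complete hc
  have hmem : (v, fun i => g i) ∈ closure testGraph := by
    refine isClosed_closure.mem_of_tendsto (f := fun n => ((u n : L2), fun i => p n i))
      (b := atTop) ?_ (Eventually.of_forall fun n => ?_)
    · refine Tendsto.prodMk_nhds hv (tendsto_pi_nhds.2 fun i => ?_)
      exact ((PiLp.continuous_apply 2 _ i).tendsto g).comp hlim
    · simp only [← hu]
      exact mem_closure_of_memH10 (u n).2
  refine ⟨⟨v, memH10_of_mem_closure hmem⟩, ?_⟩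
  ext1 i
  exact (hasWeakPartial_of_mem_closure hmem i).weakPartial_eq

/-! ### Products of sines and cosines. -/

/-- Sine for `true`, cosine for `false`. -/
def trig (b : Bool) (t : ℝ) : ℝ := if b then Real.sin t else Real.cos t

/-- The sign in `sin' = cos`, `cos' = -sin`. -/
def trigSign (b : Bool) : ℝ := if b then 1 else -1

theorem contDiff_trig (b : Bool) {n : WithTop ℕ∞} : ContDiff ℝ n (trig b) := by
  cases b
  · exact Real.contDiff_cos
  · exact Real.contDiff_sin

theorem continuous_trig (b : Bool) : Continuous (trig b) := (contDiff_trig b (n := 0)).continuous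

theorem hasDerivAt_trig (b : Bool) (t : ℝ) : HasDerivAt (trig b) (trigSign b * trig (!b) t) t := by
  cases b
  · simpa [trigSign, trig] using! Real.hasDerivAt_cos t
  · simpa [trigSign, trig] using! Real.hasDerivAt_sin t

theorem abs_trig_le_one (b : Bool) (t : ℝ) : |trig b t| ≤ 1 := by
  cases b
  · exact Real.abs_cos_le_one t
  · exact Real.abs_sin_le_one t

theorem integral_cos_int_mul_pi {j : ℤ} (hj : j ≠ 0) :
    ∫ x in (0 : ℝ)..1, Real.cos (j * Real.pi * x) = 0 := by
  have h : (j : ℝ) * Real.pi ≠ 0 := mul_ne_zero (by exact_mod_cast hj) Real.pi_ne_zero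
  rw [intervalIntegral.integral_comp_mul_left (fun x => Real.cos x) h, integral_cos]
  simp [Real.sin_int_mul_pi]

/-- Product-to-sum formulas. Because the frequencies start at π, the sum frequency never vanishes,
so sines and cosines give the same value. -/
theorem integral_trig_mul_trig (b : Bool) (m n : ℕ) :
    ∫ x in (0 : ℝ)..1, trig b ((m + 1 : ℝ) * Real.pi * x) * trig b ((n + 1 : ℝ) * Real.pi * x) =
      if m = n then 1 / 2 else 0 := by
  have e : ∀ x : ℝ,
      trig b ((m + 1 : ℝ) * Real.pi * x) * trig b ((n + 1 : ℝ) * Real.pi * x) =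
        (1 / 2) * Real.cos (((m - n : ℤ) : ℝ) * Real.pi * x) -
          trigSign b * (1 / 2) * Real.cos (((m + n + 2 : ℤ) : ℝ) * Real.pi * x) := by
    intro x
    have e1 : (((m - n : ℤ) : ℝ) * Real.pi * x) =
        (m + 1 : ℝ) * Real.pi * x - (n + 1 : ℝ) * Real.pi * x := by push_cast; ring
    have e2 : (((m + n + 2 : ℤ) : ℝ) * Real.pi * x) =
        (m + 1 : ℝ) * Real.pi * x + (n + 1 : ℝ) * Real.pi * x := by push_cast; ring
    rw [e1, e2, Real.cos_sub, Real.cos_add]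
    cases b <;> simp [trig, trigSign] <;> ring
  simp only [e]
  rw [intervalIntegral.integral_sub (Continuous.intervalIntegrable (by fun_prop) _ _)
      (Continuous.intervalIntegrable (by fun_prop) _ _),
    intervalIntegral.integral_const_mul, intervalIntegral.integral_const_mul,
    integral_cos_int_mul_pi (j := m + n + 2) (by omega), mul_zero, sub_zero]
  split_ifs with hmn
  · subst hmn; simp
  · rw [integral_cos_int_mul_pi (by omega), mul_zero]

/-- The frequency `(kᵢ + 1) π`. -/
def freq (k : Fin 2 → ℕ) (i : Fin 2) : ℝ := ((k i : ℝ) + 1) * Real.pi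

theorem one_le_freq (k : Fin 2 → ℕ) (i : Fin 2) : 1 ≤ freq k i := by
  have := Real.pi_gt_three
  have h : (0 : ℝ) ≤ k i := Nat.cast_nonneg _
  rw [freq]; nlinarith

/-- The product `2 ∏ᵢ trigᵢ((kᵢ + 1) π xᵢ)` of sines and cosines. -/
def trigProd (b : Fin 2 → Bool) (k : Fin 2 → ℕ) : C(Fin 2 → ℝ, ℝ) :=
  ⟨fun x => 2 * ∏ i, trig (b i) (freq k i * x i),
    continuous_const.mul (continuous_finsetProd _ fun i _ =>
      (continuous_trig (b i)).comp (by fun_prop))⟩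

theorem contDiff_trigProd (b : Fin 2 → Bool) (k : Fin 2 → ℕ) {n : WithTop ℕ∞} :
    ContDiff ℝ n (trigProd b k) :=
  contDiff_const.mul (contDiff_prod fun i _ => (contDiff_trig (b i)).comp (by fun_prop))

/-- The class of `trigProd b k` in `L²(Ω)`. -/
def T (b : Fin 2 → Bool) (k : Fin 2 → ℕ) : L2 := toL2 (trigProd b k)

theorem setIntegral_prod (f : Fin 2 → ℝ → ℝ) :
    ∫ x in Ω, ∏ i, f i (x i) = ∏ i, ∫ t in (0 : ℝ)..1, f i t := by
  rw [Ω_eq_pi, volume_pi, Measure.restrict_pi_pi, integral_fintype_prod_eq_prod]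
  refine Finset.prod_congr rfl fun i _ => ?_
  rw [intervalIntegral.integral_of_le zero_le_one, integral_Ioc_eq_integral_Ioo]

theorem orthonormal_T (b : Fin 2 → Bool) : Orthonormal ℝ (T b) := by
  rw [orthonormal_iff_ite]
  intro k l
  have e : ∀ x, trigProd b k x * trigProd b l x =
      4 * ∏ i, (trig (b i) (freq k i * x i) * trig (b i) (freq l i * x i)) := by
    intro x
    rw [Finset.prod_mul_distrib]
    simp only [trigProd, ContinuousMap.coe_mk]; ring
  rw [T, T, inner_toL2_toL2]
  simp only [e]
  rw [integral_const_mul, setIntegral_prod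
    (fun i t => trig (b i) (freq k i * t) * trig (b i) (freq l i * t))]
  simp only [freq, integral_trig_mul_trig, Fin.prod_univ_two]
  by_cases h0 : k 0 = l 0 <;> by_cases h1 : k 1 = l 1
  · have : k = l := by ext i; fin_cases i <;> assumption
    subst this; norm_num
  · have : k ≠ l := fun h => h1 (congrFun h 1)
    simp [h1, this]
  · have : k ≠ l := fun h => h0 (congrFun h 0)
    simp [h0, this]
  · have : k ≠ l := fun h => h0 (congrFun h 0)
    simp [h0, this]

theorem pderiv_prod (i : Fin 2) {f f' : Fin 2 → ℝ → ℝ}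
    (hf : ∀ j t, HasDerivAt (f j) (f' j t) t) (x : Fin 2 → ℝ) :
    pderiv i (fun x => 2 * ∏ j, f j (x j)) x =
      2 * ∏ j, (if j = i then f' j else f j) (x j) := by
  have hp : ∀ j : Fin 2, HasFDerivAt (fun x : Fin 2 → ℝ => f j (x j))
      (f' j (x j) • ContinuousLinearMap.proj (R := ℝ) j) x := fun j =>
    (hf j (x j)).comp_hasFDerivAt x (hasFDerivAt_apply j x)
  have h := ((hp 0).mul (hp 1)).const_mul 2
  simp only [Fin.prod_univ_two]
  have h2 : HasFDerivAt (fun x : Fin 2 → ℝ => 2 * (f 0 (x 0) * f 1 (x 1))) _ x := h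
  rw [pderiv, h2.fderiv]
  fin_cases i
  · simp; ring
  · simp

/-- Differentiation in direction `i` swaps sine and cosine in that factor only. Hence each
derivative of a sine series is again a series in one of the orthonormal systems `T b`. -/
theorem hasWeakPartial_T (i : Fin 2) (b : Fin 2 → Bool) (k : Fin 2 → ℕ) :
    HasWeakPartial i (T b k)
      ((trigSign (b i) * freq k i) • T (Function.update b i (!(b i))) k) := by
  have h := hasWeakPartial_toL2 (contDiff_trigProd b k (n := 1)) i
  suffices e : (trigSign (b i) * freq k i) • T (Function.update b i (!(b i))) k =
      toL2 (pderivC i (contDiff_trigProd b k (n := 1))) by rw [e]; exact h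
  rw [T, ← map_smul]
  congr 1
  ext x
  change _ = pderiv i (fun x => 2 * ∏ j, trig (b j) (freq k j * x j)) x
  rw [pderiv_prod i (f := fun j t => trig (b j) (freq k j * t))
    (f' := fun j t => trigSign (b j) * trig (!(b j)) (freq k j * t) * freq k j)]
  · simp only [ContinuousMap.smul_apply, trigProd, ContinuousMap.coe_mk, Fin.prod_univ_two,
      smul_eq_mul]
    fin_cases i <;> simp [Function.update] <;> ring
  · intro j t
    refine (hasDerivAt_trig (b j) (freq k j * t)).comp t ?_
    simpa using (hasDerivAt_id t).const_mul (freq k j)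

/-- The choice of the sine in both variables. -/
def ss : Fin 2 → Bool := fun _ => true

/-- Links the basis to the span defining `VM`: indices here start at 0, mode numbers at 1, and the
factor 2 is the L² normalization. -/
theorem T_ss_eq (k : Fin 2 → ℕ) : T ss k = (2 : ℝ) • mode (k 0 + 1) (k 1 + 1) := by
  have h : mode (k 0 + 1) (k 1 + 1) = toL2 ⟨fun x => Real.sin ((k 0 + 1 : ℕ) * Real.pi * x 0) *
    Real.sin ((k 1 + 1 : ℕ) * Real.pi * x 1), by fun_prop⟩ := rfl
  rw [h, ← map_smul, T]
  congr 1
  ext x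
  simp [trigProd, trig, ss, freq, Fin.prod_univ_two]

/-! ### Cutoffs near the boundary: the sine products lie in H¹₀. -/

theorem deriv_smoothTransition_of_one_lt {t : ℝ} (h : 1 < t) :
    deriv Real.smoothTransition t = 0 := by
  have e : Real.smoothTransition =ᶠ[𝓝 t] fun _ => 1 := by
    filter_upwards [lt_mem_nhds h] with s hs using Real.smoothTransition.one_of_one_le hs.le
  rw [e.deriv_eq, deriv_const]

theorem deriv_smoothTransition_of_neg {t : ℝ} (h : t < 0) :
    deriv Real.smoothTransition t = 0 := by
  have e : Real.smoothTransition =ᶠ[𝓝 t] fun _ => 0 := by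
    filter_upwards [gt_mem_nhds h] with s hs using Real.smoothTransition.zero_of_nonpos hs.le
  rw [e.deriv_eq, deriv_const]

/-- The derivative lives on 1 ≤ s ≤ 2. With s = n t this absorbs the factor n from differentiating
the cutoff into the linear vanishing of the sine at the endpoint. -/
theorem exists_bound_deriv_smoothTransition :
    ∃ C : ℝ, 0 ≤ C ∧ ∀ s : ℝ, |s * deriv Real.smoothTransition (s - 1)| ≤ C := by
  have hc : Continuous (deriv Real.smoothTransition) :=
    (Real.smoothTransition.contDiff (n := 1)).continuous_deriv (by simp)
  obtain ⟨C, hC⟩ := (isCompact_Icc (a := (1 : ℝ)) (b := 2)).exists_bound_of_continuousOn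
    (f := fun s : ℝ => s * deriv Real.smoothTransition (s - 1)) (by fun_prop)
  refine ⟨max C 0, le_max_right _ _, fun s => ?_⟩
  rcases lt_or_ge s 1 with h1 | h1
  · rw [deriv_smoothTransition_of_neg (by linarith)]; simp
  rcases lt_or_ge 2 s with h2 | h2
  · rw [deriv_smoothTransition_of_one_lt (by linarith)]; simp
  exact (hC s ⟨h1, h2⟩).trans (le_max_left _ _)

/-- `sin (p t)`, cut off smoothly near the endpoints of `(0,1)`. -/
def cutSin (n : ℕ) (p t : ℝ) : ℝ :=
  Real.smoothTransition (n * t - 1) * Real.smoothTransition (n * (1 - t) - 1) * Real.sin (p * t)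

/-- The derivative of `cutSin n p`. -/
def cutSinDeriv (n : ℕ) (p t : ℝ) : ℝ :=
  (deriv Real.smoothTransition (n * t - 1) * n * Real.smoothTransition (n * (1 - t) - 1) +
    Real.smoothTransition (n * t - 1) *
      (deriv Real.smoothTransition (n * (1 - t) - 1) * (n * (-1)))) * Real.sin (p * t) +
  Real.smoothTransition (n * t - 1) * Real.smoothTransition (n * (1 - t) - 1) *
    (Real.cos (p * t) * p)

theorem contDiff_cutSin (n : ℕ) (p : ℝ) : ContDiff ℝ ∞ (cutSin n p) := by
  have h : ContDiff ℝ ∞ Real.smoothTransition := Real.smoothTransition.contDiff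
  have h1 : ContDiff ℝ ∞ fun t : ℝ => Real.smoothTransition (n * t - 1) := h.comp (by fun_prop)
  have h2 : ContDiff ℝ ∞ fun t : ℝ => Real.smoothTransition (n * (1 - t) - 1) :=
    h.comp (by fun_prop)
  exact (h1.mul h2).mul (by fun_prop)

theorem hasDerivAt_cutSin (n : ℕ) (p t : ℝ) :
    HasDerivAt (cutSin n p) (cutSinDeriv n p t) t := by
  have h : ∀ s, HasDerivAt Real.smoothTransition (deriv Real.smoothTransition s) s := fun s =>
    ((Real.smoothTransition.contDiff (n := 1)).differentiable (by simp) s).hasDerivAt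
  have i1 : HasDerivAt (fun t : ℝ => n * t - 1) n t := by
    simpa using! ((hasDerivAt_id t).const_mul (n : ℝ)).sub_const 1
  have i2 : HasDerivAt (fun t : ℝ => n * (1 - t) - 1) (n * (-1)) t := by
    simpa using! (((hasDerivAt_id t).const_sub 1).const_mul (n : ℝ)).sub_const 1
  have h1 : HasDerivAt (fun t : ℝ => Real.smoothTransition (n * t - 1)) _ t := (h _).comp t i1
  have h2 : HasDerivAt (fun t : ℝ => Real.smoothTransition (n * (1 - t) - 1)) _ t :=
    (h _).comp t i2
  have h3 : HasDerivAt (fun t : ℝ => Real.sin (p * t)) (Real.cos (p * t) * p) t :=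
    (Real.hasDerivAt_sin _).comp t (by simpa using (hasDerivAt_id t).const_mul p)
  exact (h1.mul h2).mul h3

theorem abs_smoothTransition_le_one (t : ℝ) : |Real.smoothTransition t| ≤ 1 := by
  rw [abs_of_nonneg (Real.smoothTransition.nonneg t)]
  exact Real.smoothTransition.le_one t

theorem abs_cutSin_le_one (n : ℕ) (p t : ℝ) : |cutSin n p t| ≤ 1 := by
  rw [cutSin, abs_mul, abs_mul]
  exact mul_le_one₀ (mul_le_one₀ (abs_smoothTransition_le_one _) (abs_nonneg _)
    (abs_smoothTransition_le_one _)) (abs_nonneg _) (Real.abs_sin_le_one _)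

/-- Reflection about 1/2, which reduces the cutoff at the right endpoint to the one at the left. -/
theorem abs_sin_sub_of_sin_eq_zero {p : ℝ} (hp : Real.sin p = 0) (t : ℝ) :
    |Real.sin (p * t)| = |Real.sin (p * (1 - t))| := by
  have h1 : |Real.cos p| = 1 := by
    have := Real.sin_sq_add_cos_sq p
    rw [hp] at this
    rw [← sq_eq_sq₀ (abs_nonneg _) zero_le_one, sq_abs]
    linarith
  rw [mul_sub, mul_one, Real.sin_sub, hp, zero_mul, zero_sub, abs_neg, abs_mul, h1, one_mul]

/-- The point is uniformity in `n`: the cutoff slope is of order n only where the distance to the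
endpoint is of order 1/n, and there |sin| is at most `p` times that distance. -/
theorem abs_cutSinDeriv_le {C : ℝ} (hC : ∀ s : ℝ, |s * deriv Real.smoothTransition (s - 1)| ≤ C)
    (n : ℕ) {p : ℝ} (hp0 : 0 ≤ p) (hp : Real.sin p = 0) {t : ℝ} (ht : t ∈ Set.Ioo (0 : ℝ) 1) :
    |cutSinDeriv n p t| ≤ C * p + C * p + p := by
  have key : ∀ s : ℝ, 0 ≤ s → |deriv Real.smoothTransition (n * s - 1) * n| * |Real.sin (p * s)| ≤
      C * p := by
    intro s hs
    have h1 : |Real.sin (p * s)| ≤ p * s := by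
      refine Real.abs_sin_le_abs.trans ?_
      rw [abs_of_nonneg (mul_nonneg hp0 hs)]
    calc |deriv Real.smoothTransition (n * s - 1) * n| * |Real.sin (p * s)|
        ≤ |deriv Real.smoothTransition (n * s - 1) * n| * (p * s) := by gcongr
      _ = |n * s * deriv Real.smoothTransition (n * s - 1)| * p := by
        rw [abs_mul, abs_mul, abs_mul, abs_of_nonneg hs]; ring
      _ ≤ C * p := by gcongr; exact hC _
  have hs1 := abs_smoothTransition_le_one (n * t - 1)
  have hs2 := abs_smoothTransition_le_one (n * (1 - t) - 1)
  rw [cutSinDeriv, add_mul]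
  refine (abs_add_three _ _ _).trans (add_le_add (add_le_add ?_ ?_) ?_)
  · rw [abs_mul, abs_mul _ (Real.smoothTransition _), mul_right_comm]
    exact (mul_le_of_le_one_right (by positivity) hs2).trans (key t ht.1.le)
  · rw [abs_mul, abs_mul (Real.smoothTransition _), mul_assoc, abs_sin_sub_of_sin_eq_zero hp]
    refine (mul_le_of_le_one_left (by positivity) hs1).trans ?_
    rw [mul_neg_one, mul_neg, abs_neg]
    exact key (1 - t) (by linarith [ht.2])
  · rw [abs_mul, abs_mul, abs_mul, abs_of_nonneg hp0, ← mul_assoc]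
    exact mul_le_of_le_one_left hp0 (mul_le_one₀ (mul_le_one₀ hs1 (abs_nonneg _) hs2)
      (abs_nonneg _) (Real.abs_cos_le_one _))

theorem eventually_two_lt_mul {t : ℝ} (ht : 0 < t) : ∀ᶠ n : ℕ in atTop, 2 < n * t :=
  (tendsto_natCast_atTop_atTop.atTop_mul_const ht).eventually_gt_atTop 2

theorem tendsto_cutSin (p : ℝ) {t : ℝ} (ht : t ∈ Set.Ioo (0 : ℝ) 1) :
    Tendsto (fun n => cutSin n p t) atTop (𝓝 (Real.sin (p * t))) := by
  refine tendsto_const_nhds.congr' ?_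
  filter_upwards [eventually_two_lt_mul ht.1, eventually_two_lt_mul (sub_pos.2 ht.2)] with n h1 h2
  rw [cutSin, Real.smoothTransition.one_of_one_le (by linarith),
    Real.smoothTransition.one_of_one_le (by linarith)]
  ring

theorem tendsto_cutSinDeriv (p : ℝ) {t : ℝ} (ht : t ∈ Set.Ioo (0 : ℝ) 1) :
    Tendsto (fun n => cutSinDeriv n p t) atTop (𝓝 (Real.cos (p * t) * p)) := by
  refine tendsto_const_nhds.congr' ?_
  filter_upwards [eventually_two_lt_mul ht.1, eventually_two_lt_mul (sub_pos.2 ht.2)] with n h1 h2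
  rw [cutSinDeriv, Real.smoothTransition.one_of_one_le (by linarith),
    Real.smoothTransition.one_of_one_le (by linarith),
    deriv_smoothTransition_of_one_lt (by linarith), deriv_smoothTransition_of_one_lt (by linarith)]
  ring

theorem sin_freq (k : Fin 2 → ℕ) (i : Fin 2) : Real.sin (freq k i) = 0 := by
  rw [freq]
  exact_mod_cast Real.sin_nat_mul_pi (k i + 1)

theorem isTest_prod_cutSin (n : ℕ) (p : Fin 2 → ℝ) :
    IsTest (fun x => 2 * ∏ i, cutSin n (p i) (x i)) := by
  have hK : IsClosed {x : Fin 2 → ℝ | ∀ i, 1 ≤ n * x i ∧ 1 ≤ n * (1 - x i)} := by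
    simp only [Set.ofPred_forall, Set.ofPred_and]
    exact isClosed_iInter fun i => (isClosed_le (by fun_prop) (by fun_prop)).inter
      (isClosed_le (by fun_prop) (by fun_prop))
  have hKΩ : {x : Fin 2 → ℝ | ∀ i, 1 ≤ n * x i ∧ 1 ≤ n * (1 - x i)} ⊆ Ω := by
    intro x hx i
    have hn : (0 : ℝ) ≤ n := Nat.cast_nonneg n
    have key : ∀ s : ℝ, 1 ≤ n * s → 0 < s := by
      intro s hs
      by_contra! h
      linarith [mul_nonpos_of_nonneg_of_nonpos hn h]
    exact ⟨key _ (hx i).1, sub_pos.1 (key _ (hx i).2)⟩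
  have hsupp : tsupport (fun x : Fin 2 → ℝ => 2 * ∏ i, cutSin n (p i) (x i)) ⊆
      {x : Fin 2 → ℝ | ∀ i, 1 ≤ n * x i ∧ 1 ≤ n * (1 - x i)} := by
    refine closure_minimal (fun x hx i => ?_) hK
    by_contra hcon
    refine hx ?_
    have h0 : cutSin n (p i) (x i) = 0 := by
      rw [not_and_or, not_le, not_le] at hcon
      rw [cutSin]
      rcases hcon with h | h
      · rw [Real.smoothTransition.zero_of_nonpos (x := n * x i - 1) (by linarith)]; ring
      · rw [Real.smoothTransition.zero_of_nonpos (x := n * (1 - x i) - 1) (by linarith)]; ring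
    change 2 * ∏ i, cutSin n (p i) (x i) = 0
    rw [Finset.prod_eq_zero (Finset.mem_univ i) h0, mul_zero]
  refine ⟨contDiff_const.mul (contDiff_prod fun i _ => (contDiff_cutSin n (p i)).comp
    (by fun_prop)), ?_, hsupp.trans hKΩ⟩
  exact isCompact_Icc.of_isClosed_subset (isClosed_tsupport _)
    ((hsupp.trans hKΩ).trans Ω_subset_Icc)

/-- The products of cut-off sines are test functions. They and their gradients are bounded uniformly
in `n` and converge pointwise in `Ω`, hence converge in L². -/
theorem T_ss_mem_H10 (k : Fin 2 → ℕ) : T ss k ∈ H10 := by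
  obtain ⟨C, hC0, hC⟩ := exists_bound_deriv_smoothTransition
  have htest := fun n => isTest_prod_cutSin n (freq k)
  have hpos : ∀ i, 0 ≤ freq k i := fun i => zero_le_one.trans (one_le_freq k i)
  refine memH10_of_mem_closure
    (g := fun i => toL2 (pderivC i (contDiff_trigProd ss k (n := 1)))) ?_
  refine isClosed_closure.mem_of_tendsto (b := atTop)
    (f := fun n => ((htest n).cls, fun i => (htest n).dcls i)) ?_
    (Eventually.of_forall fun n => subset_closure ⟨_, htest n, rfl⟩)
  refine Tendsto.prodMk_nhds ?_ (tendsto_pi_nhds.2 fun i => ?_)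
  · refine tendsto_toL2 (C := 2) (fun n x _ => ?_) (fun x hx => ?_)
    · change |2 * ∏ i, cutSin n (freq k i) (x i)| ≤ 2
      rw [abs_mul, abs_two, Finset.abs_prod]
      exact mul_le_of_le_one_right two_pos.le
        (Finset.prod_le_one (fun _ _ => abs_nonneg _) fun i _ => abs_cutSin_le_one _ _ _)
    · exact (tendsto_finsetProd _ fun i _ => tendsto_cutSin (freq k i) (hx i)).const_mul 2
  · let B : ℝ := ∑ i, (C * freq k i + C * freq k i + freq k i)
    have hB : ∀ i, C * freq k i + C * freq k i + freq k i ≤ B := fun i =>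
      Finset.single_le_sum (f := fun i => C * freq k i + C * freq k i + freq k i)
        (fun i _ => by have := hpos i; positivity) (Finset.mem_univ i)
    have e1 : ∀ n x, pderivC i (htest n).contDiff_one x = 2 * ∏ j, (if j = i then
        cutSinDeriv n (freq k j) else cutSin n (freq k j)) (x j) := fun n x =>
      pderiv_prod i (fun j t => hasDerivAt_cutSin n (freq k j) t) x
    have e2 : ∀ x, pderivC i (contDiff_trigProd ss k (n := 1)) x = 2 * ∏ j, (if j = i then
        (fun t => Real.cos (freq k j * t) * freq k j)
          else (fun t => Real.sin (freq k j * t))) (x j) := fun x => by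
      refine pderiv_prod i (f := fun j t => Real.sin (freq k j * t)) (fun j t => ?_) x
      exact (Real.hasDerivAt_sin _).comp t (by simpa using (hasDerivAt_id t).const_mul (freq k j))
    refine tendsto_toL2 (C := 2 * ∏ _ : Fin 2, max B 1) (fun n x hx => ?_) (fun x hx => ?_)
    · rw [e1, abs_mul, abs_two, Finset.abs_prod]
      refine mul_le_mul_of_nonneg_left
        (Finset.prod_le_prod (fun _ _ => abs_nonneg _) fun j _ => ?_) two_pos.le
      split_ifs
      · exact ((abs_cutSinDeriv_le hC n (hpos j) (sin_freq k j) (hx j)).trans (hB j)).trans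
          (le_max_left _ _)
      · exact (abs_cutSin_le_one _ _ _).trans (le_max_right _ _)
    · simp only [e1, e2]
      refine (tendsto_finsetProd _ fun j _ => ?_).const_mul 2
      split_ifs
      · exact tendsto_cutSinDeriv (freq k j) (hx j)
      · exact tendsto_cutSin (freq k j) (hx j)

/-! ### Completeness of the sine products in L²(Ω). -/

/-- The continuous functions that multiply the span of the sine products into itself. -/
def sineMultipliers : Subalgebra ℝ C(Fin 2 → ℝ, ℝ) where
  carrier := {a | ∀ s ∈ Submodule.span ℝ (Set.range (trigProd ss)),
    a * s ∈ Submodule.span ℝ (Set.range (trigProd ss))}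
  mul_mem' ha hb s hs := by rw [mul_assoc]; exact ha _ (hb s hs)
  add_mem' ha hb s hs := by rw [add_mul]; exact Submodule.add_mem _ (ha s hs) (hb s hs)
  algebraMap_mem' r s hs := by
    rw [← Algebra.smul_def]; exact Submodule.smul_mem _ r hs

/-- The function `cos (π xᵢ)`. -/
def cosCoord (i : Fin 2) : C(Fin 2 → ℝ, ℝ) := ⟨fun x => Real.cos (Real.pi * x i), by fun_prop⟩

/-- 2 cos(πx) sin(jπx) = sin((j+1)πx) + sin((j-1)πx). At the lowest frequency the second term is sin
0, which is why that case is split off. -/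
theorem cosCoord_mem (i : Fin 2) : cosCoord i ∈ sineMultipliers := by
  intro s hs
  induction hs using Submodule.span_induction with
  | zero => rw [mul_zero]; exact Submodule.zero_mem _
  | add s t _ _ h1 h2 => rw [mul_add]; exact Submodule.add_mem _ h1 h2
  | smul c s _ h => rw [mul_smul_comm]; exact Submodule.smul_mem _ c h
  | mem s hs =>
    obtain ⟨k, rfl⟩ := hs
    have hup : trigProd ss (Function.update k i (k i + 1)) ∈
        Submodule.span ℝ (Set.range (trigProd ss)) := Submodule.subset_span ⟨_, rfl⟩
    rcases Nat.eq_zero_or_pos (k i) with h0 | h0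
    · have e : cosCoord i * trigProd ss k =
          (1 / 2 : ℝ) • trigProd ss (Function.update k i (k i + 1)) := by
        ext x
        have h2 : Real.sin ((1 + 1) * Real.pi * x i) =
            2 * Real.sin (Real.pi * x i) * Real.cos (Real.pi * x i) := by
          rw [← Real.sin_two_mul]; ring_nf
        fin_cases i <;>
          simp [cosCoord, trigProd, trig, ss, freq, Fin.prod_univ_two, Function.update] at h0 h2 ⊢ <;>
          simp [h0, h2] <;> ring
      rw [e]
      exact Submodule.smul_mem _ _ hup
    · have hdown : trigProd ss (Function.update k i (k i - 1)) ∈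
        Submodule.span ℝ (Set.range (trigProd ss)) := Submodule.subset_span ⟨_, rfl⟩
      have e : cosCoord i * trigProd ss k =
          (1 / 2 : ℝ) • trigProd ss (Function.update k i (k i + 1)) +
          (1 / 2 : ℝ) • trigProd ss (Function.update k i (k i - 1)) := by
        ext x
        have h1 : Real.sin ((k i + 1 + 1) * Real.pi * x i) =
            Real.sin ((k i + 1) * Real.pi * x i + Real.pi * x i) := by ring_nf
        have h2 : Real.sin (k i * Real.pi * x i) =
            Real.sin ((k i + 1) * Real.pi * x i - Real.pi * x i) := by ring_nf
        rw [Real.sin_add] at h1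
        rw [Real.sin_sub] at h2
        have h3 : ((k i - 1 : ℕ) : ℝ) + 1 = k i := by
          rw [Nat.cast_sub h0]; simp
        fin_cases i <;>
          simp [cosCoord, trigProd, trig, ss, freq, Fin.prod_univ_two, Function.update]
            at h1 h2 h3 ⊢ <;>
          simp only [h1, h2, h3] <;> ring
      rw [e]
      exact Submodule.add_mem _ (Submodule.smul_mem _ _ hup) (Submodule.smul_mem _ _ hdown)

/-- Stone-Weierstrass on the closed square. The two functions cos(πxᵢ) separate points because
cosine is injective on [0, π]. -/
theorem exists_sineMultiplier_near (q : C(Fin 2 → ℝ, ℝ)) {ε : ℝ} (hε : 0 < ε) :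
    ∃ a ∈ sineMultipliers, ∀ x ∈ Ω, |a x - q x| ≤ ε := by
  let K : Set (Fin 2 → ℝ) := Set.Icc 0 1
  have : CompactSpace K := isCompact_iff_compactSpace.1 isCompact_Icc
  let r : C(K, Fin 2 → ℝ) := ⟨Subtype.val, continuous_subtype_val⟩
  let A : Subalgebra ℝ C(K, ℝ) := sineMultipliers.map (ContinuousMap.compRightAlgHom ℝ ℝ r)
  have hA : A.SeparatesPoints := by
    intro x y hxy
    obtain ⟨i, hi⟩ : ∃ i, x.1 i ≠ y.1 i := by
      by_contra! h
      exact hxy (Subtype.ext (funext h))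
    refine ⟨fun z => cosCoord i z.1,
      ⟨_, ⟨cosCoord i, cosCoord_mem i, rfl⟩, rfl⟩, fun h => hi ?_⟩
    have hI : ∀ z : K, Real.pi * z.1 i ∈ Set.Icc 0 Real.pi := fun z =>
      ⟨mul_nonneg Real.pi_pos.le (z.2.1 i), mul_le_of_le_one_right Real.pi_pos.le (z.2.2 i)⟩
    exact mul_left_cancel₀ Real.pi_ne_zero (Real.injOn_cos (hI x) (hI y) h)
  obtain ⟨⟨_, a, ha, rfl⟩, hg⟩ :=
    ContinuousMap.exists_mem_subalgebra_near_continuousMap_of_separatesPoints A hA (q.comp r) ε hε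
  refine ⟨a, ha, fun x hx => ?_⟩
  exact (ContinuousMap.norm_coe_le_norm _ (⟨x, Ω_subset_Icc hx⟩ : K)).trans hg.le

/-- The lowest sine product is positive in `Ω` and `φ` vanishes near the boundary, so the quotient
is continuous on the plane. -/
theorem IsTest.exists_eq_mul {φ : (Fin 2 → ℝ) → ℝ} (h : IsTest φ) :
    ∃ q : C(Fin 2 → ℝ, ℝ), h.toC = q * trigProd ss 0 := by
  have hne : ∀ x ∈ Ω, trigProd ss 0 x ≠ 0 := by
    intro x hx
    have : ∀ i, Real.sin (Real.pi * x i) ≠ 0 := fun i =>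
      (Real.sin_pos_of_pos_of_lt_pi (mul_pos Real.pi_pos (hx i).1)
        (mul_lt_of_lt_one_right Real.pi_pos (hx i).2)).ne'
    simp [trigProd, trig, ss, freq, this]
  refine ⟨⟨fun x => φ x / trigProd ss 0 x, continuous_iff_continuousAt.2 fun x => ?_⟩, ?_⟩
  · by_cases hx : x ∈ tsupport φ
    · exact h.smooth.continuous.continuousAt.div (trigProd ss 0).continuous.continuousAt
        (hne x (h.subset hx))
    · have e : (fun x => φ x / trigProd ss 0 x) =ᶠ[𝓝 x] fun _ => 0 := by
        filter_upwards [notMem_tsupport_iff_eventuallyEq.1 hx] with y hy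
        rw [hy]; simp
      exact continuousAt_const.congr e.symm
  · ext x
    by_cases hx : x ∈ Ω
    · exact (div_mul_cancel₀ (φ x) (hne x hx)).symm
    · have : φ x = 0 := image_eq_zero_of_notMem_tsupport fun h' => hx (h.subset h')
      change φ x = φ x / trigProd ss 0 x * trigProd ss 0 x
      rw [this]; simp

/-- Write a test function as `q` times the lowest sine product and replace `q` by a uniformly close
multiplier: the new product lies in the sine span, which `g` annihilates. Thus `g` annihilates every
test function. -/
theorem eq_zero_of_inner_T_eq_zero {g : L2} (hg : ∀ k, inner ℝ g (T ss k) = 0) : g = 0 := by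
  have hspan : ∀ s ∈ Submodule.span ℝ (Set.range (trigProd ss)), inner ℝ g (toL2 s) = 0 := by
    intro s hs
    induction hs using Submodule.span_induction with
    | zero => simp
    | add s t _ _ h1 h2 => rw [map_add, inner_add_right, h1, h2, add_zero]
    | smul c s _ h => rw [map_smul, inner_smul_right, h, mul_zero]
    | mem s hs => obtain ⟨k, rfl⟩ := hs; exact hg k
  have htest : ∀ φ, ∀ h : IsTest φ, inner ℝ g h.cls = 0 := by
    intro φ h
    obtain ⟨q, hq⟩ := h.exists_eq_mul
    let m : ℝ := measureUnivNNReal μΩ ^ ((2 : ℝ≥0∞).toReal⁻¹)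
    have hm : 0 ≤ m := by positivity
    have hbound : ∀ ε : ℝ, 0 < ε → |inner ℝ g h.cls| ≤ ‖g‖ * (m * 2) * ε := by
      intro ε hε
      obtain ⟨a, ha, hq'⟩ := exists_sineMultiplier_near q hε
      have h0 := hspan _ (ha (trigProd ss 0) (Submodule.subset_span ⟨0, rfl⟩))
      have e : inner ℝ g h.cls = - inner ℝ g (toL2 ((a - q) * trigProd ss 0)) := by
        rw [sub_mul, map_sub, inner_sub_right, h0, IsTest.cls, hq]; ring
      have h2 : ‖toL2 ((a - q) * trigProd ss 0)‖ ≤ m * (ε * 2) := by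
        refine norm_toL2_le (by positivity) fun x hx => ?_
        rw [ContinuousMap.mul_apply, abs_mul]
        refine mul_le_mul (hq' x hx) ?_ (abs_nonneg _) hε.le
        change |2 * ∏ i, trig (ss i) (freq 0 i * x i)| ≤ 2
        rw [abs_mul, abs_two, Finset.abs_prod]
        exact mul_le_of_le_one_right two_pos.le
          (Finset.prod_le_one (fun _ _ => abs_nonneg _) fun i _ => abs_trig_le_one _ _)
      rw [e, abs_neg]
      refine (abs_real_inner_le_norm _ _).trans ?_
      calc ‖g‖ * ‖toL2 ((a - q) * trigProd ss 0)‖ ≤ ‖g‖ * (m * (ε * 2)) := by gcongr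
        _ = ‖g‖ * (m * 2) * ε := by ring
    have hlim : Tendsto (fun ε : ℝ => ‖g‖ * (m * 2) * ε) (𝓝[>] 0) (𝓝 0) := by
      have : Tendsto (fun ε : ℝ => ‖g‖ * (m * 2) * ε) (𝓝 0) (𝓝 (‖g‖ * (m * 2) * 0)) :=
        tendsto_id.const_mul _
      rw [mul_zero] at this
      exact this.mono_left nhdsWithin_le_nhds
    have := ge_of_tendsto hlim (eventually_mem_nhdsWithin.mono fun ε hε => hbound ε hε)
    exact abs_nonpos_iff.1 this
  -- Orthogonality to all test functions says that `g` is a weak derivative of 0, so uniqueness of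
  -- weak derivatives gives `g = 0`.
  have hw : HasWeakPartial 0 0 g := by
    rw [hasWeakPartial_iff]
    intro φ h
    rw [htest φ h, inner_zero_left, neg_zero]
  exact hw.unique (HasWeakPartial.zero 0)

/-- The sine products as a Hilbert basis of `L²(Ω)`. -/
def sineBasis : HilbertBasis (Fin 2 → ℕ) ℝ L2 :=
  HilbertBasis.mkOfOrthogonalEqBot (orthonormal_T ss) <| by
    rw [Submodule.eq_bot_iff]
    intro g hg
    refine eq_zero_of_inner_T_eq_zero fun k => ?_
    rw [real_inner_comm]
    exact hg _ (Submodule.subset_span ⟨k, rfl⟩)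

theorem sineBasis_apply (k : Fin 2 → ℕ) : sineBasis k = T ss k := by
  rw [sineBasis, HilbertBasis.coe_mkOfOrthogonalEqBot]

/-! ### Sine coefficients of H² ∩ H¹₀ functions. -/

theorem hasSum_sq_inner_T (u : L2) : HasSum (fun k => inner ℝ (T ss k) u ^ 2) (‖u‖ ^ 2) := by
  have h := sineBasis.hasSum_inner_mul_inner u u
  rw [real_inner_self_eq_norm_sq] at h
  refine h.congr_fun fun k => ?_
  rw [sineBasis_apply, real_inner_comm, sq]

theorem weakPartial_T_ss (i : Fin 2) (k : Fin 2 → ℕ) :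
    weakPartial i (T ss k) = freq k i • T (Function.update ss i false) k := by
  rw [(hasWeakPartial_T i ss k).weakPartial_eq]
  simp [trigSign, ss]

theorem hasWeakPartial_weakPartial_T_ss (i j : Fin 2) (k : Fin 2 → ℕ) :
    HasWeakPartial j (weakPartial i (T ss k))
      ((freq k i * (trigSign (Function.update ss i false j) * freq k j)) •
        T (Function.update (Function.update ss i false) j (!(Function.update ss i false j))) k) := by
  rw [weakPartial_T_ss, mul_smul]
  exact (hasWeakPartial_T j _ k).smul _

theorem hasWeakPartial_weakPartial_T_ss_self (i : Fin 2) (k : Fin 2 → ℕ) :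
    HasWeakPartial i (weakPartial i (T ss k)) (-(freq k i ^ 2) • T ss k) := by
  have h := hasWeakPartial_weakPartial_T_ss i i k
  have e : Function.update (Function.update ss i false) i
      (!(Function.update ss i false i)) = ss := by
    funext j
    by_cases hj : j = i
    · subst hj; simp [ss]
    · simp [hj]
  rw [e] at h
  convert h using 2
  simp [trigSign]; ring

theorem MemH2.hasWeakPartial {u : L2} (h : MemH2 u) (i j : Fin 2) :
    HasWeakPartial j (weakPartial i u) (weakPartial j (weakPartial i u)) :=
  hasWeakPartial_weakPartial (h.2 i j)

/-- Two integrations by parts: the first has no boundary term because the sine product is in `H10`,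
the second because `u` is. -/
theorem inner_T_weakPartial_weakPartial {u : L2} (h0 : u ∈ H10) (h2 : MemH2 u) (i : Fin 2)
    (k : Fin 2 → ℕ) :
    inner ℝ (T ss k) (weakPartial i (weakPartial i u)) = -(freq k i ^ 2) * inner ℝ (T ss k) u := by
  have h1 := inner_weakPartial_right (T_ss_mem_H10 k) (h2.hasWeakPartial i i)
  have h3 := inner_weakPartial_right h0 (hasWeakPartial_weakPartial_T_ss_self i k)
  rw [real_inner_comm, h1, inner_smul_left, real_inner_comm] at h3
  simp only [conj_trivial] at h3
  linarith

/-- The weak Laplacian. -/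
def lap (u : L2) : L2 := ∑ i, weakPartial i (weakPartial i u)

/-- The eigenvalue of `-Δ` belonging to `T ss k`. -/
def lam (k : Fin 2 → ℕ) : ℝ := ∑ i, freq k i ^ 2

theorem inner_T_lap {u : L2} (h0 : u ∈ H10) (h2 : MemH2 u) (k : Fin 2 → ℕ) :
    inner ℝ (T ss k) (lap u) = -lam k * inner ℝ (T ss k) u := by
  simp only [lap, inner_sum, inner_T_weakPartial_weakPartial h0 h2, lam]
  rw [← Finset.sum_mul, Finset.sum_neg_distrib]

theorem freq_sq_le_lam (k : Fin 2 → ℕ) (i : Fin 2) : freq k i ^ 2 ≤ lam k :=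
  Finset.single_le_sum (f := fun i => freq k i ^ 2) (fun _ _ => sq_nonneg _) (Finset.mem_univ i)

theorem freq_le_lam (k : Fin 2 → ℕ) (i : Fin 2) : freq k i ≤ lam k :=
  (le_self_pow₀ (one_le_freq k i) two_ne_zero).trans (freq_sq_le_lam k i)

theorem freq_mul_freq_le_lam (k : Fin 2 → ℕ) (i j : Fin 2) : freq k i * freq k j ≤ lam k := by
  have h1 := freq_sq_le_lam k i
  have h2 := freq_sq_le_lam k j
  nlinarith [sq_nonneg (freq k i - freq k j)]

theorem one_le_lam (k : Fin 2 → ℕ) : 1 ≤ lam k := (one_le_freq k 0).trans (freq_le_lam k 0)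

theorem abs_trigSign (b : Bool) : |trigSign b| = 1 := by cases b <;> simp [trigSign]

/-! ### Truncation of the sine series: error and stability. -/

/-- The indices of the modes with both mode numbers at most `M`. -/
def lowIndices (M : ℕ) : Finset (Fin 2 → ℕ) := Fintype.piFinset fun _ => Finset.range M

/-- The truncated sine series of `u`. -/
def trunc (M : ℕ) (u : L2) : L2 := ∑ k ∈ lowIndices M, inner ℝ (T ss k) u • T ss k

theorem trunc_mem_H10 (M : ℕ) (u : L2) : trunc M u ∈ H10 :=
  Submodule.sum_mem _ fun k _ => Submodule.smul_mem _ _ (T_ss_mem_H10 k)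

theorem trunc_mem_VM (M : ℕ) (u : L2) : (⟨trunc M u, trunc_mem_H10 M u⟩ : H10) ∈ VM M := by
  change trunc M u ∈ Submodule.span ℝ _
  refine Submodule.sum_mem _ fun k hk => Submodule.smul_mem _ _ ?_
  rw [T_ss_eq]
  have hk' : ∀ i, k i < M := by simpa [lowIndices] using hk
  exact Submodule.smul_mem _ _ (Submodule.subset_span
    ⟨k 0 + 1, k 1 + 1, by omega, hk' 0, by omega, hk' 1, rfl⟩)

theorem inner_T_trunc (M : ℕ) (u : L2) (k : Fin 2 → ℕ) :
    inner ℝ (T ss k) (trunc M u) = if k ∈ lowIndices M then inner ℝ (T ss k) u else 0 := by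
  simp only [trunc, inner_sum, inner_smul_right, orthonormal_iff_ite.1 (orthonormal_T ss)]
  simp

theorem sq_le_lam_of_notMem {M : ℕ} {k : Fin 2 → ℕ} (hk : k ∉ lowIndices M) :
    (M : ℝ) ^ 2 ≤ lam k := by
  obtain ⟨i, hi⟩ : ∃ i, M ≤ k i := by
    by_contra! h
    exact hk (by simpa [lowIndices] using h)
  refine le_trans ?_ (freq_sq_le_lam k i)
  have h1 : (M : ℝ) ≤ k i := by exact_mod_cast hi
  have h2 := Real.pi_gt_three
  refine pow_le_pow_left₀ (Nat.cast_nonneg _) ?_ 2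
  rw [freq]
  have : (0 : ℝ) ≤ k i := Nat.cast_nonneg _
  nlinarith

/-- Parseval, coefficient by coefficient: omitted modes carry the factor `lam k ≥ M²`. -/
theorem norm_sub_trunc_le {u : L2} (h0 : u ∈ H10) (h2 : MemH2 u) (M : ℕ) :
    (M : ℝ) ^ 2 * ‖u - trunc M u‖ ≤ ‖lap u‖ := by
  refine (sq_le_sq₀ (by positivity) (norm_nonneg _)).1 ?_
  rw [mul_pow]
  refine hasSum_le (fun k => ?_) ((hasSum_sq_inner_T (u - trunc M u)).mul_left (((M : ℝ) ^ 2) ^ 2))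
    (hasSum_sq_inner_T (lap u))
  rw [inner_sub_right, inner_T_trunc, inner_T_lap h0 h2, neg_mul, neg_sq]
  split_ifs with hk
  · rw [sub_self, zero_pow two_ne_zero, mul_zero]; positivity
  · rw [sub_zero, mul_pow]
    exact mul_le_mul_of_nonneg_right
      (pow_le_pow_left₀ (by positivity) (sq_le_lam_of_notMem hk) 2) (sq_nonneg _)

theorem hasWeakPartial_trunc (M : ℕ) (u : L2) (i : Fin 2) :
    HasWeakPartial i (trunc M u)
      (∑ k ∈ lowIndices M, inner ℝ (T ss k) u • weakPartial i (T ss k)) :=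
  HasWeakPartial.sum _ fun k => (hasWeakPartial_of_memH10 (T_ss_mem_H10 k) i).smul _

theorem hasWeakPartial_weakPartial_trunc (M : ℕ) (u : L2) (i j : Fin 2) :
    HasWeakPartial j (weakPartial i (trunc M u))
      (∑ k ∈ lowIndices M, inner ℝ (T ss k) u • weakPartial j (weakPartial i (T ss k))) := by
  rw [(hasWeakPartial_trunc M u i).weakPartial_eq]
  exact HasWeakPartial.sum _ fun k =>
    (hasWeakPartial_weakPartial ⟨_, hasWeakPartial_weakPartial_T_ss i j k⟩).smul _

theorem normH10_sq (u : H10) :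
    normH10 u ^ 2 = ∑ i, inner ℝ (weakPartial i (u : L2)) (weakPartial i (u : L2)) := by
  rw [normH10, Real.sq_sqrt (by positivity)]
  simp only [real_inner_self_eq_norm_sq]

theorem normH10_nonneg (u : H10) : 0 ≤ normH10 u := Real.sqrt_nonneg _

theorem normH10_sub_trunc_le (u : H10) (h2 : MemH2 u) {M : ℕ} (hM : 0 < M) :
    normH10 (u - ⟨trunc M u, trunc_mem_H10 M u⟩) ≤ ‖lap (u : L2)‖ / M := by
  set w : H10 := ⟨trunc M u, trunc_mem_H10 M u⟩ with hw
  set e : H10 := u - w with he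
  -- The error has no low-frequency coefficients, and ∂ᵢ² maps the truncation back into the low
  -- modes, so the two gradients are orthogonal.
  have horth : ∀ i, inner ℝ (weakPartial i (w : L2)) (weakPartial i (e : L2)) = 0 := by
    intro i
    rw [inner_weakPartial_right e.2 (hasWeakPartial_weakPartial_trunc M u i i), sum_inner,
      neg_eq_zero]
    refine Finset.sum_eq_zero fun k hk => ?_
    rw [(hasWeakPartial_weakPartial_T_ss_self i k).weakPartial_eq, inner_smul_left,
      inner_smul_left, he]
    change _ * (_ * inner ℝ (T ss k) ((u : L2) - trunc M u)) = 0
    rw [inner_sub_right, inner_T_trunc, if_pos hk, sub_self, mul_zero, mul_zero]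
  have h1 : normH10 e ^ 2 = - inner ℝ (lap (u : L2)) (e : L2) := by
    rw [normH10_sq, lap, sum_inner, ← Finset.sum_neg_distrib]
    refine Finset.sum_congr rfl fun i _ => ?_
    rw [← inner_weakPartial_right e.2 (h2.hasWeakPartial i i)]
    have e1 : weakPartial i (e : L2) = weakPartial i (u : L2) - weakPartial i (w : L2) := by
      have := congrArg (fun p : PiLp 2 (fun _ : Fin 2 => L2) => p i) (map_sub grad u w)
      exact this
    nth_rewrite 1 [e1]
    rw [inner_sub_left, horth, sub_zero]
  have h3 : normH10 e ^ 2 ≤ ‖lap (u : L2)‖ * ‖(e : L2)‖ := by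
    rw [h1]
    exact (neg_le_abs _).trans (abs_real_inner_le_norm _ _)
  have h4 : (M : ℝ) ^ 2 * ‖(e : L2)‖ ≤ ‖lap (u : L2)‖ := norm_sub_trunc_le u.2 h2 M
  have hM' : (0 : ℝ) < M := by exact_mod_cast hM
  -- Combining ‖∇e‖² ≤ ‖Δu‖‖e‖ with M²‖e‖ ≤ ‖Δu‖ avoids any Parseval identity for gradients.
  rw [le_div_iff₀ hM']
  refine (sq_le_sq₀ (mul_nonneg (normH10_nonneg _) hM'.le) (norm_nonneg _)).1 ?_
  calc (normH10 e * M) ^ 2 = M ^ 2 * normH10 e ^ 2 := by ring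
    _ ≤ M ^ 2 * (‖lap (u : L2)‖ * ‖(e : L2)‖) := by gcongr
    _ = ‖lap (u : L2)‖ * (M ^ 2 * ‖(e : L2)‖) := by ring
    _ ≤ ‖lap (u : L2)‖ * ‖lap (u : L2)‖ := by gcongr
    _ = ‖lap (u : L2)‖ ^ 2 := by ring

/-- Orthonormality of `T b`, then comparison with Parseval for Δu, whose coefficients carry the
weights `lam k`. -/
theorem norm_sum_smul_T_le {u : L2} (h0 : u ∈ H10) (h2 : MemH2 u) (s : Finset (Fin 2 → ℕ))
    (b : Fin 2 → Bool) {d : (Fin 2 → ℕ) → ℝ} (hd : ∀ k, |d k| ≤ lam k) :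
    ‖∑ k ∈ s, inner ℝ (T ss k) u • d k • T b k‖ ≤ ‖lap u‖ := by
  refine (sq_le_sq₀ (norm_nonneg _) (norm_nonneg _)).1 ?_
  simp only [smul_smul]
  rw [← real_inner_self_eq_norm_sq, (orthonormal_T b).inner_sum]
  refine le_trans (Finset.sum_le_sum fun k _ => ?_)
    (sum_le_hasSum s (fun _ _ => sq_nonneg _) (hasSum_sq_inner_T (lap u)))
  rw [inner_T_lap h0 h2, neg_mul, neg_sq, conj_trivial, ← sq, mul_comm, mul_pow, mul_pow,
    ← sq_abs (d k)]
  exact mul_le_mul_of_nonneg_right (pow_le_pow_left₀ (abs_nonneg _) (hd k) 2) (sq_nonneg _)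

theorem normH2_trunc_le {u : L2} (h0 : u ∈ H10) (h2 : MemH2 u) (M : ℕ) :
    normH2 (trunc M u) ≤ 3 * ‖lap u‖ := by
  have hfreq : ∀ k i, |freq k i| = freq k i := fun k i =>
    abs_of_nonneg (zero_le_one.trans (one_le_freq k i))
  have hn0 : ‖trunc M u‖ ≤ ‖lap u‖ := by
    have := norm_sum_smul_T_le h0 h2 (lowIndices M) ss (d := fun _ => 1)
      (fun k => by rw [abs_one]; exact one_le_lam k)
    simpa [trunc] using this
  have hn1 : ∀ i, ‖weakPartial i (trunc M u)‖ ≤ ‖lap u‖ := fun i => by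
    rw [(hasWeakPartial_trunc M u i).weakPartial_eq]
    simp only [weakPartial_T_ss]
    exact norm_sum_smul_T_le h0 h2 _ _ fun k => by rw [hfreq]; exact freq_le_lam k i
  have hn2 : ∀ i j, ‖weakPartial j (weakPartial i (trunc M u))‖ ≤ ‖lap u‖ := fun i j => by
    rw [(hasWeakPartial_weakPartial_trunc M u i j).weakPartial_eq]
    simp only [(hasWeakPartial_weakPartial_T_ss i j _).weakPartial_eq]
    refine norm_sum_smul_T_le h0 h2 _ _ fun k => ?_
    rw [abs_mul, abs_mul, abs_trigSign, one_mul, hfreq, hfreq]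
    exact freq_mul_freq_le_lam k i j
  refine Real.sqrt_le_iff.2 ⟨by positivity, ?_⟩
  have hsq : ∀ {v : L2}, ‖v‖ ≤ ‖lap u‖ → ‖v‖ ^ 2 ≤ ‖lap u‖ ^ 2 := fun h =>
    pow_le_pow_left₀ (norm_nonneg _) h 2
  have h1 := hsq hn0
  have h3 := hsq (hn1 0)
  have h4 := hsq (hn1 1)
  have h5 := hsq (hn2 0 0)
  have h6 := hsq (hn2 0 1)
  have h7 := hsq (hn2 1 0)
  have h8 := hsq (hn2 1 1)
  simp only [Fin.sum_univ_two]
  -- The H² norm has seven squared terms, each at most ‖Δu‖², and 7 ≤ 3².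
  nlinarith [sq_nonneg ‖lap u‖]

theorem normH2_nonneg (u : L2) : 0 ≤ normH2 u := Real.sqrt_nonneg _

theorem norm_weakPartial_weakPartial_le_normH2 (u : L2) (i j : Fin 2) :
    ‖weakPartial j (weakPartial i u)‖ ≤ normH2 u := by
  refine Real.le_sqrt_of_sq_le ?_
  have h1 : ‖weakPartial j (weakPartial i u)‖ ^ 2 ≤
      ∑ i, ∑ j, ‖weakPartial j (weakPartial i u)‖ ^ 2 :=
    (Finset.single_le_sum (f := fun j => ‖weakPartial j (weakPartial i u)‖ ^ 2)
      (fun _ _ => sq_nonneg _) (Finset.mem_univ j)).trans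
      (Finset.single_le_sum (f := fun i => ∑ j, ‖weakPartial j (weakPartial i u)‖ ^ 2)
        (fun _ _ => by positivity) (Finset.mem_univ i))
  have h2 : 0 ≤ ‖u‖ ^ 2 + ∑ i, ‖weakPartial i u‖ ^ 2 := by positivity
  linarith

theorem norm_lap_le (u : L2) : ‖lap u‖ ≤ 2 * normH2 u := by
  refine (norm_sum_le _ _).trans ?_
  rw [Fin.sum_univ_two, two_mul]
  exact add_le_add (norm_weakPartial_weakPartial_le_normH2 u 0 0)
    (norm_weakPartial_weakPartial_le_normH2 u 1 1)

/-! ### The energy form, Lax-Milgram and the Galerkin problems. -/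

/-- The weighted inner product `∫_Ω κ g · k` of vector fields. -/
def energy (κ : (Fin 2 → ℝ) → ℝ) (g k : PiLp 2 (fun _ : Fin 2 => L2)) : ℝ :=
  ∫ x in Ω, κ x * ∑ i, g i x * k i x

theorem aForm_eq_energy (κ : (Fin 2 → ℝ) → ℝ) (u v : H10) :
    aForm κ u v = energy κ (grad u) (grad v) := rfl

section Energy

variable {κ : (Fin 2 → ℝ) → ℝ} {κmin κmax : ℝ}

theorem IsElliptic.kmax_pos (hκ : IsElliptic κ κmin κmax) : 0 < κmax := by
  have h : (fun _ => 1 / 2 : Fin 2 → ℝ) ∈ Ω := fun _ => by norm_num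
  exact hκ.pos.trans_le ((hκ.lower _ h).trans (hκ.upper _ h))

theorem IsElliptic.abs_le (hκ : IsElliptic κ κmin κmax) {x : Fin 2 → ℝ} (hx : x ∈ Ω) :
    |κ x| ≤ κmax := by
  rw [abs_of_pos (hκ.pos.trans_le (hκ.lower x hx))]
  exact hκ.upper x hx

theorem integrable_mul_L2 (f g : L2) : Integrable (fun x => f x * g x) μΩ :=
  (Lp.memLp f).integrable_mul (Lp.memLp g)

theorem IsElliptic.integrable_mul (hκ : IsElliptic κ κmin κmax) {F : (Fin 2 → ℝ) → ℝ}
    (hF : Integrable F μΩ) : Integrable (fun x => κ x * F x) μΩ :=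
  hF.bdd_mul hκ.meas (c := κmax) (by
    filter_upwards [ae_mem_Ω] with x hx using hκ.abs_le hx)

theorem integrable_dot (g k : PiLp 2 (fun _ : Fin 2 => L2)) :
    Integrable (fun x => ∑ i, g i x * k i x) μΩ :=
  integrable_finsetSum _ fun i _ => integrable_mul_L2 (g i) (k i)

theorem energy_comm (g k : PiLp 2 (fun _ : Fin 2 => L2)) : energy κ g k = energy κ k g := by
  simp only [energy, mul_comm]

theorem IsElliptic.energy_add (hκ : IsElliptic κ κmin κmax)
    (g g' k : PiLp 2 (fun _ : Fin 2 => L2)) :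
    energy κ (g + g') k = energy κ g k + energy κ g' k := by
  rw [energy, energy, energy, ← integral_add (hκ.integrable_mul (integrable_dot _ _))
    (hκ.integrable_mul (integrable_dot _ _))]
  refine integral_congr_ae ?_
  filter_upwards [Lp.coeFn_add (g 0) (g' 0), Lp.coeFn_add (g 1) (g' 1)] with x h0 h1
  simp only [Fin.sum_univ_two, PiLp.add_apply, h0, h1, Pi.add_apply]
  ring

theorem energy_smul (c : ℝ) (g k : PiLp 2 (fun _ : Fin 2 => L2)) :
    energy κ (c • g) k = c * energy κ g k := by
  rw [energy, energy, ← integral_const_mul]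
  refine integral_congr_ae ?_
  filter_upwards [Lp.coeFn_smul c (g 0), Lp.coeFn_smul c (g 1)] with x h0 h1
  simp only [Fin.sum_univ_two, PiLp.smul_apply, h0, h1, Pi.smul_apply, smul_eq_mul]
  ring

theorem integral_abs_mul_le (f g : L2) : ∫ x in Ω, |f x| * |g x| ≤ ‖f‖ * ‖g‖ := by
  have e : ∫ x in Ω, |f x| * |g x| = inner ℝ |f| |g| := by
    rw [L2_inner_eq]
    refine integral_congr_ae ?_
    filter_upwards [Lp.coeFn_abs f, Lp.coeFn_abs g] with x h1 h2
    rw [h1, h2]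
  rw [e, ← norm_abs_eq_norm f, ← norm_abs_eq_norm g]
  exact real_inner_le_norm _ _

theorem IsElliptic.abs_energy_le (hκ : IsElliptic κ κmin κmax)
    (g k : PiLp 2 (fun _ : Fin 2 => L2)) : |energy κ g k| ≤ 2 * κmax * ‖g‖ * ‖k‖ := by
  have hint : ∀ i, Integrable (fun x => |g i x| * |k i x|) μΩ := fun i => by
    simpa [abs_mul] using (integrable_mul_L2 (g i) (k i)).abs
  have h1 : |energy κ g k| ≤ ∫ x in Ω, κmax * ∑ i, |g i x| * |k i x| := by
    rw [energy, ← Real.norm_eq_abs]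
    refine norm_integral_le_of_norm_le ((integrable_finsetSum _ fun i _ => hint i).const_mul _) ?_
    filter_upwards [ae_mem_Ω] with x hx
    rw [norm_mul]
    refine mul_le_mul (hκ.abs_le hx) ?_ (norm_nonneg _) hκ.kmax_pos.le
    refine (norm_sum_le _ _).trans_eq (Finset.sum_congr rfl fun i _ => ?_)
    rw [norm_mul]; rfl
  rw [integral_const_mul, integral_finsetSum _ fun i _ => hint i] at h1
  refine h1.trans ?_
  have h2 : ∀ i, ∫ x in Ω, |g i x| * |k i x| ≤ ‖g‖ * ‖k‖ := fun i =>
    (integral_abs_mul_le _ _).trans (mul_le_mul (PiLp.norm_apply_le g i) (PiLp.norm_apply_le k i)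
      (norm_nonneg _) (norm_nonneg _))
  have h3 : ∑ i, ∫ x in Ω, |g i x| * |k i x| ≤ 2 * (‖g‖ * ‖k‖) := by
    rw [Fin.sum_univ_two, two_mul]; exact add_le_add (h2 0) (h2 1)
  calc κmax * ∑ i, ∫ x in Ω, |g i x| * |k i x| ≤ κmax * (2 * (‖g‖ * ‖k‖)) :=
        mul_le_mul_of_nonneg_left h3 hκ.kmax_pos.le
    _ = 2 * κmax * ‖g‖ * ‖k‖ := by ring

theorem IsElliptic.le_energy_self (hκ : IsElliptic κ κmin κmax)
    (g : PiLp 2 (fun _ : Fin 2 => L2)) : κmin * ‖g‖ ^ 2 ≤ energy κ g g := by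
  have e : ‖g‖ ^ 2 = ∫ x in Ω, ∑ i, g i x * g i x := by
    rw [PiLp.norm_sq_eq_of_L2, integral_finsetSum _ fun i _ => integrable_mul_L2 (g i) (g i)]
    refine Finset.sum_congr rfl fun i _ => ?_
    rw [← L2_inner_eq, real_inner_self_eq_norm_sq]
  rw [e, energy, ← integral_const_mul]
  refine integral_mono_ae ((integrable_dot g g).const_mul _)
    (hκ.integrable_mul (integrable_dot g g)) ?_
  filter_upwards [ae_mem_Ω] with x hx
  exact mul_le_mul_of_nonneg_right (hκ.lower x hx)
    (Finset.sum_nonneg fun i _ => mul_self_nonneg _)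

/-- `energy` as a continuous bilinear form. -/
def IsElliptic.energyCLM (hκ : IsElliptic κ κmin κmax) :
    PiLp 2 (fun _ : Fin 2 => L2) →L[ℝ] PiLp 2 (fun _ : Fin 2 => L2) →L[ℝ] ℝ :=
  LinearMap.mkContinuous₂
    (LinearMap.mk₂ ℝ (energy κ) hκ.energy_add energy_smul
      (fun g k k' => by
        rw [energy_comm, hκ.energy_add, energy_comm k, energy_comm k'])
      (fun c g k => by rw [energy_comm, energy_smul, energy_comm k]; rfl))
    (2 * κmax) hκ.abs_energy_le

theorem IsElliptic.energyCLM_apply (hκ : IsElliptic κ κmin κmax)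
    (g k : PiLp 2 (fun _ : Fin 2 => L2)) : hκ.energyCLM g k = energy κ g k := rfl

/-- The Lax-Milgram theorem for a bounded coercive form `B`, restricted to the image of a subspace
under a linear map, if this image is complete. -/
theorem exists_galerkin {V X : Type*} [AddCommGroup V] [Module ℝ V] [NormedAddCommGroup X]
    [InnerProductSpace ℝ X] (G : V →ₗ[ℝ] X) (B : X →L[ℝ] X →L[ℝ] ℝ) {c : ℝ} (hc : 0 < c)
    (hB : ∀ x, c * ‖x‖ ^ 2 ≤ B x x) (ℓ : V →ₗ[ℝ] ℝ) {C : ℝ} (hℓ : ∀ v, |ℓ v| ≤ C * ‖G v‖)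
    (S : Submodule ℝ V) (hS : IsComplete (S.map G : Set X)) :
    ∃ u ∈ S, ∀ v ∈ S, B (G u) (G v) = ℓ v := by
  have : CompleteSpace (S.map G) := hS.completeSpace_coe
  let R := S.map G
  let B' : R →L[ℝ] R →L[ℝ] ℝ := B.bilinearComp R.subtypeL R.subtypeL
  have hcoer : IsCoercive B' := ⟨c, hc, fun x => by
    have := hB x.1
    change c * ‖x.1‖ * ‖x.1‖ ≤ B x.1 x.1
    rw [mul_assoc, ← sq]; exact this⟩
  have hsec : ∀ r : R, ∃ v ∈ S, G v = r := fun r => r.2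
  choose σ hσS hσ using hsec
  -- The bound on `ℓ` makes it constant on the fibres of `G`, so it descends to the image;
  -- injectivity of `G` is not required.
  have hker : ∀ v w, G v = G w → ℓ v = ℓ w := by
    intro v w h
    have h1 := hℓ (v - w)
    rw [map_sub, map_sub, h, sub_self, norm_zero, mul_zero] at h1
    exact sub_eq_zero.1 (abs_nonpos_iff.1 h1)
  let m : R →ₗ[ℝ] ℝ :=
    { toFun := fun r => ℓ (σ r)
      map_add' := fun r s => by
        rw [← map_add]
        exact hker _ _ (by rw [hσ, map_add, hσ, hσ]; rfl)
      map_smul' := fun a r => by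
        rw [← map_smul]
        exact hker _ _ (by rw [hσ, map_smul, hσ]; rfl) }
  let mL : R →L[ℝ] ℝ := m.mkContinuous C fun r => by
    have := hℓ (σ r)
    rwa [hσ] at this
  let z : R := (InnerProductSpace.toDual ℝ R).symm mL
  let y : R := hcoer.continuousLinearEquivOfBilin.symm z
  refine ⟨σ y, hσS y, fun v hv => ?_⟩
  let r : R := ⟨G v, v, hv, rfl⟩
  have h1 := hcoer.continuousLinearEquivOfBilin_apply y r
  rw [ContinuousLinearEquiv.apply_symm_apply, InnerProductSpace.toDual_symm_apply] at h1
  rw [hσ]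
  refine h1.symm.trans (hker _ _ ?_)
  rw [hσ]

/-- `ell f` as a linear map. -/
def ellLM (f : L2) : H10 →ₗ[ℝ] ℝ := (innerSL ℝ f).toLinearMap ∘ₗ H10.subtype

theorem ell_eq_inner (f : L2) (v : H10) : ell f v = inner ℝ f (v : L2) := (L2_inner_eq _ _).symm

theorem abs_ell_le (f : L2) (v : H10) : |ell f v| ≤ 2 * ‖f‖ * normH10 v := by
  rw [ell_eq_inner]
  refine (abs_real_inner_le_norm _ _).trans ?_
  have := mul_le_mul_of_nonneg_left (norm_le_normH10 v) (norm_nonneg f)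
  linarith

theorem IsElliptic.exists_isGalerkin (hκ : IsElliptic κ κmin κmax) (f : L2)
    (S : Submodule ℝ H10) (hS : IsComplete (S.map grad : Set (PiLp 2 (fun _ : Fin 2 => L2)))) :
    ∃ u, IsGalerkin κ f S u := by
  obtain ⟨u, hu, h⟩ := exists_galerkin grad hκ.energyCLM hκ.pos hκ.le_energy_self (ellLM f)
    (C := 2 * ‖f‖) (fun v => by
      rw [norm_grad]
      have := abs_ell_le f v
      rwa [ell_eq_inner] at this) S hS
  refine ⟨u, hu, fun v hv => ?_⟩
  rw [ell_eq_inner]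
  exact h v hv

theorem IsElliptic.exists_isGalerkin_of_finiteDimensional (hκ : IsElliptic κ κmin κmax) (f : L2)
    (S : Submodule ℝ H10) [FiniteDimensional ℝ S] : ∃ u, IsGalerkin κ f S u :=
  hκ.exists_isGalerkin f S (Submodule.complete_of_finiteDimensional (S.map grad))

theorem IsElliptic.exists_isWeakSolution (hκ : IsElliptic κ κmin κmax) (f : L2) :
    ∃ u, IsWeakSolution κ f u := by
  obtain ⟨u, _, hu⟩ := hκ.exists_isGalerkin f ⊤ (by
    have := isComplete_range_grad
    rwa [← Set.image_univ] at this)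
  exact ⟨u, fun v => hu v trivial⟩

theorem IsElliptic.aForm_sub_left (hκ : IsElliptic κ κmin κmax) (u v w : H10) :
    aForm κ (u - v) w = aForm κ u w - aForm κ v w := by
  simp only [aForm_eq_energy, ← hκ.energyCLM_apply, map_sub, sub_apply]

theorem IsElliptic.aForm_sub_right (hκ : IsElliptic κ κmin κmax) (u v w : H10) :
    aForm κ w (u - v) = aForm κ w u - aForm κ w v := by
  simp only [aForm_eq_energy, ← hκ.energyCLM_apply, map_sub]

theorem aForm_comm (u v : H10) : aForm κ u v = aForm κ v u :=
  energy_comm (grad u) (grad v)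

theorem IsElliptic.abs_aForm_le (hκ : IsElliptic κ κmin κmax) (u v : H10) :
    |aForm κ u v| ≤ 2 * κmax * normH10 u * normH10 v := by
  rw [← norm_grad, ← norm_grad]; exact hκ.abs_energy_le (grad u) (grad v)

theorem IsElliptic.le_aForm_self (hκ : IsElliptic κ κmin κmax) (u : H10) :
    κmin * normH10 u ^ 2 ≤ aForm κ u u := by
  rw [← norm_grad]; exact hκ.le_energy_self (grad u)

theorem eq_zero_of_normH10_eq_zero {u : H10} (h : normH10 u = 0) : u = 0 := by
  have := norm_le_normH10 u
  rw [h, mul_zero] at this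
  exact Subtype.ext (norm_le_zero_iff.1 this)

theorem IsElliptic.eq_zero_of_aForm_self_eq_zero (hκ : IsElliptic κ κmin κmax) {u : H10}
    (h : aForm κ u u = 0) : u = 0 := by
  have h1 := hκ.le_aForm_self u
  rw [h] at h1
  refine eq_zero_of_normH10_eq_zero (pow_eq_zero_iff two_ne_zero |>.1 (le_antisymm ?_ (sq_nonneg _)))
  exact nonpos_of_mul_nonpos_right h1 hκ.pos

theorem IsElliptic.isWeakSolution_unique (hκ : IsElliptic κ κmin κmax) {f : L2} {u v : H10}
    (hu : IsWeakSolution κ f u) (hv : IsWeakSolution κ f v) : u = v := by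
  refine sub_eq_zero.1 (hκ.eq_zero_of_aForm_self_eq_zero ?_)
  rw [hκ.aForm_sub_left, hu, hv, sub_self]

/-! ### The solution operator and its H² bound. -/

/-- The solution operator `f ↦ u`. -/
def IsElliptic.solve (hκ : IsElliptic κ κmin κmax) : L2 →ₗ[ℝ] H10 where
  toFun f := (hκ.exists_isWeakSolution f).choose
  map_add' f g := by
    refine hκ.isWeakSolution_unique (hκ.exists_isWeakSolution (f + g)).choose_spec fun v => ?_
    have h1 := (hκ.exists_isWeakSolution f).choose_spec v
    have h2 := (hκ.exists_isWeakSolution g).choose_spec v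
    rw [ell_eq_inner, inner_add_left, ← ell_eq_inner, ← ell_eq_inner, ← h1, ← h2]
    simp only [aForm_eq_energy, map_add, hκ.energy_add]
  map_smul' c f := by
    refine hκ.isWeakSolution_unique (hκ.exists_isWeakSolution (c • f)).choose_spec fun v => ?_
    have h1 := (hκ.exists_isWeakSolution f).choose_spec v
    rw [ell_eq_inner, inner_smul_left, ← ell_eq_inner, ← h1]
    simp only [aForm_eq_energy, map_smul, energy_smul]
    rfl

theorem IsElliptic.isWeakSolution_solve (hκ : IsElliptic κ κmin κmax) (f : L2) :
    IsWeakSolution κ f (hκ.solve f) := (hκ.exists_isWeakSolution f).choose_spec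

theorem IsElliptic.normH10_solve_le (hκ : IsElliptic κ κmin κmax) (f : L2) :
    normH10 (hκ.solve f) ≤ 2 / κmin * ‖f‖ := by
  have h1 := hκ.le_aForm_self (hκ.solve f)
  rw [hκ.isWeakSolution_solve f] at h1
  have h2 := h1.trans ((le_abs_self _).trans (abs_ell_le f _))
  rw [div_mul_eq_mul_div, le_div_iff₀ hκ.pos]
  rcases (normH10_nonneg (hκ.solve f)).eq_or_lt with h0 | h0
  · rw [← h0, zero_mul]; positivity
  · refine le_of_mul_le_mul_right ?_ h0
    calc normH10 (hκ.solve f) * κmin * normH10 (hκ.solve f)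
        = κmin * normH10 (hκ.solve f) ^ 2 := by ring
      _ ≤ _ := h2

/-- The gradient of the solution, as a continuous function of the right-hand side. -/
def IsElliptic.gradSolve (hκ : IsElliptic κ κmin κmax) :
    L2 →L[ℝ] PiLp 2 (fun _ : Fin 2 => L2) :=
  (grad ∘ₗ hκ.solve).mkContinuous (2 / κmin) fun f => by
    rw [LinearMap.comp_apply, norm_grad]; exact hκ.normH10_solve_le f

/-- Closed graph theorem: if the data and the second derivatives converge, the gradients converge by
the energy estimate, so the limit is the second derivative of the limiting solution. -/
theorem IsElliptic.exists_bound_second_partial (hκ : IsElliptic κ κmin κmax)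
    (hreg : H2Regular κ) (i j : Fin 2) :
    ∃ C : ℝ, ∀ f, ‖weakPartial j (weakPartial i (hκ.solve f : L2))‖ ≤ C * ‖f‖ := by
  have hw : ∀ f, HasWeakPartial j (hκ.gradSolve f i)
      (weakPartial j (weakPartial i (hκ.solve f : L2))) := fun f =>
    (hreg f _ (hκ.isWeakSolution_solve f)).hasWeakPartial i j
  let D : L2 →ₗ[ℝ] L2 :=
    { toFun := fun f => weakPartial j (weakPartial i (hκ.solve f : L2))
      map_add' := fun f g => by
        refine (hw (f + g)).unique ?_
        rw [map_add]
        exact (hw f).add (hw g)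
      map_smul' := fun c f => by
        refine (hw (c • f)).unique ?_
        rw [map_smul]
        exact (hw f).smul c }
  have hD : Continuous D := by
    refine D.continuous_of_seq_closed_graph fun f f' g hf hg => ?_
    refine HasWeakPartial.unique (HasWeakPartial.of_tendsto (fun n => hw (f n)) ?_ hg) (hw f')
    exact (((PiLp.continuous_apply 2 _ i).comp hκ.gradSolve.continuous).tendsto f').comp hf
  exact ⟨‖(⟨D, hD⟩ : L2 →L[ℝ] L2)‖, fun f => (⟨D, hD⟩ : L2 →L[ℝ] L2).le_opNorm f⟩

/-- The a priori estimate in `H²(Ω)`, from mere membership and the closed graph theorem. -/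
theorem IsElliptic.exists_bound_normH2 (hκ : IsElliptic κ κmin κmax) (hreg : H2Regular κ) :
    ∃ C : ℝ, 0 ≤ C ∧ ∀ f u, IsWeakSolution κ f u → normH2 u ≤ C * ‖f‖ := by
  choose D hD using fun i j => hκ.exists_bound_second_partial hreg i j
  set A : ℝ := 2 / κmin with hA
  have hA0 : 0 ≤ A := by have := hκ.pos; positivity
  refine ⟨√((2 * A) ^ 2 + A ^ 2 + ∑ i, ∑ j, D i j ^ 2), Real.sqrt_nonneg _, fun f u hu => ?_⟩
  rw [hκ.isWeakSolution_unique hu (hκ.isWeakSolution_solve f)]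
  refine Real.sqrt_le_iff.2 ⟨by positivity, ?_⟩
  rw [mul_pow, Real.sq_sqrt (by positivity), add_mul, add_mul, ← mul_pow, ← mul_pow,
    Finset.sum_mul]
  have h1 := hκ.normH10_solve_le f
  refine add_le_add (add_le_add ?_ ?_) (Finset.sum_le_sum fun i _ => ?_)
  · refine pow_le_pow_left₀ (norm_nonneg _) ((norm_le_normH10 _).trans ?_) 2
    rw [mul_assoc]; exact mul_le_mul_of_nonneg_left h1 two_pos.le
  · refine le_trans (le_of_eq ?_) (pow_le_pow_left₀ (normH10_nonneg _) h1 2)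
    rw [normH10, Real.sq_sqrt (by positivity)]
  · rw [Finset.sum_mul]
    refine Finset.sum_le_sum fun j _ => ?_
    rw [← mul_pow]
    exact pow_le_pow_left₀ (norm_nonneg _) (hD i j f) 2

end Energy

/-! ### Céa's lemma and approximation from the reduced space. -/

theorem normH10_add_le (u v : H10) : normH10 (u + v) ≤ normH10 u + normH10 v := by
  simp only [← norm_grad, map_add]
  exact norm_add_le _ _

theorem normH10_sub_comm (u v : H10) : normH10 (u - v) = normH10 (v - u) := by
  simp only [← norm_grad, map_sub]
  exact norm_sub_rev _ _

section Discretization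

variable {κ : (Fin 2 → ℝ) → ℝ} {κmin κmax : ℝ} {f : L2} {u uh : H10} {Vh : Submodule ℝ H10}

/-- Céa's lemma, relative to a Galerkin solution in a larger space. -/
theorem IsElliptic.normH10_sub_galerkin_le (hκ : IsElliptic κ κmin κmax) {W : Submodule ℝ H10}
    (hW : W ≤ Vh) {w : H10} (huh : IsGalerkin κ f Vh uh) (hw : IsGalerkin κ f W w) {v : H10}
    (hv : v ∈ W) : normH10 (uh - w) ≤ 2 * κmax / κmin * normH10 (uh - v) := by
  have horth : aForm κ (uh - w) (w - v) = 0 := by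
    have hmem : w - v ∈ W := W.sub_mem hw.1 hv
    rw [hκ.aForm_sub_left, huh.2 _ (hW hmem), hw.2 _ hmem, sub_self]
  have e : aForm κ (uh - w) (uh - w) = aForm κ (uh - w) (uh - v) := by
    have h := hκ.aForm_sub_right (uh - v) (w - v) (uh - w)
    rw [horth, sub_zero, sub_sub_sub_cancel_right] at h
    exact h
  have h1 := hκ.le_aForm_self (uh - w)
  rw [e] at h1
  have h2 := h1.trans ((le_abs_self _).trans (hκ.abs_aForm_le _ _))
  rw [div_mul_eq_mul_div, le_div_iff₀ hκ.pos]
  rcases (normH10_nonneg (uh - w)).eq_or_lt with h0 | h0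
  · rw [← h0, zero_mul]
    have := hκ.kmax_pos
    have := normH10_nonneg (uh - v)
    positivity
  · refine le_of_mul_le_mul_right ?_ h0
    linarith

theorem IsEnergyProjection.normH10_le {P : H10 →ₗ[ℝ] Vh} (hP : IsEnergyProjection κ Vh P)
    (hκ : IsElliptic κ κmin κmax) (w : H10) :
    normH10 (P w : H10) ≤ 2 * κmax / κmin * normH10 w := by
  have h1 := hκ.le_aForm_self (P w : H10)
  rw [hP w _ (P w).2] at h1
  have h2 := h1.trans ((le_abs_self _).trans (hκ.abs_aForm_le _ _))
  rw [div_mul_eq_mul_div, le_div_iff₀ hκ.pos]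
  rcases (normH10_nonneg (P w : H10)).eq_or_lt with h0 | h0
  · rw [← h0, zero_mul]
    have := hκ.kmax_pos
    have := normH10_nonneg w
    positivity
  · refine le_of_mul_le_mul_right ?_ h0
    linarith

theorem IsEnergyProjection.apply_eq_galerkin {P : H10 →ₗ[ℝ] Vh} (hP : IsEnergyProjection κ Vh P)
    (hκ : IsElliptic κ κmin κmax) (hu : IsWeakSolution κ f u) (huh : IsGalerkin κ f Vh uh) :
    (P u : H10) = uh := by
  refine sub_eq_zero.1 (hκ.eq_zero_of_aForm_self_eq_zero ?_)
  have hmem : (P u : H10) - uh ∈ Vh := Vh.sub_mem (P u).2 huh.1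
  rw [hκ.aForm_sub_left, hP u _ hmem, hu, huh.2 _ hmem, sub_self]

/-- The low-mode space approximates the discrete solution to first order. -/
theorem IsElliptic.exists_mem_VMh_near (hκ : IsElliptic κ κmin κmax) {C₀ h : ℝ} (hC₀ : 0 < C₀)
    (hh : 0 < h) (hFE : FEErrorBound κ Vh h C₀) {M : ℕ} (hM : 0 < M) {P : H10 →ₗ[ℝ] Vh}
    (hP : IsEnergyProjection κ Vh P ∨ ApproxProperty M Vh P h C₀) (hu : IsWeakSolution κ f u)
    (hu2 : MemH2 u) (huh : IsGalerkin κ f Vh uh) :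
    ∃ v ∈ VMh M Vh P, normH10 (uh - v) ≤
      (7 * C₀ + 2 + 2 * (2 * κmax / κmin)) * (h + 1 / M) * normH2 u := by
  -- The truncated sine series is the low-mode candidate. In the constant, 2 comes from ‖Δu‖ ≤ 2‖u‖
  -- in H², 7`C₀` from the branch with the approximation property, and the last summand from the
  -- stability of the energy projection.
  set w : H10 := ⟨trunc M u, trunc_mem_H10 M u⟩
  have hwVM : w ∈ VM M := trunc_mem_VM M u
  refine ⟨P w, ⟨w, hwVM, rfl⟩, ?_⟩
  have hM' : (0 : ℝ) < M := by exact_mod_cast hM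
  have hN := normH2_nonneg (u : L2)
  have hlap := norm_lap_le (u : L2)
  have hR : 0 < 2 * κmax / κmin := div_pos (mul_pos two_pos hκ.kmax_pos) hκ.pos
  have huw : normH10 (u - w) ≤ 2 * (1 / M) * normH2 u := by
    refine (normH10_sub_trunc_le u hu2 hM).trans ?_
    rw [div_le_iff₀ hM']
    refine hlap.trans_eq ?_
    field_simp
  have h1 := hFE f u uh hu hu2 huh
  have hδ : (0 : ℝ) < 1 / M := by positivity
  generalize (1 : ℝ) / M = δ at *
  generalize normH2 (u : L2) = N at *
  have n1 : 0 ≤ C₀ * h * N := by positivity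
  have n2 : 0 ≤ C₀ * δ * N := by positivity
  have n3 : 0 ≤ h * N := by positivity
  have n4 : 0 ≤ δ * N := by positivity
  rcases hP with hP | hP
  -- The energy projection of `u` is the discrete solution, so the difference is the projection of
  -- the truncation error and stability suffices.
  · rw [← hP.apply_eq_galerkin hκ hu huh]
    have e : (P u : H10) - P w = P (u - w) := by rw [map_sub]; rfl
    rw [e]
    refine (hP.normH10_le hκ _).trans ((mul_le_mul_of_nonneg_left huw hR.le).trans ?_)
    generalize 2 * κmax / κmin = R at *
    have n5 : 0 ≤ R * h * N := by positivity
    linarith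
  -- Here the error splits into finite element, truncation and projection parts. The first costs
  -- `C₀`, the last 6`C₀`, since the truncation has H² norm at most 3‖Δu‖ ≤ 6`N`.
  · have hw2 : normH2 (w : L2) ≤ 6 * N :=
      (normH2_trunc_le u.2 hu2 M).trans (by linarith)
    have h2 := hP w hwVM
    have h3 : C₀ * h * normH2 (w : L2) ≤ C₀ * h * (6 * N) := by gcongr
    have e : uh - (P w : H10) = (uh - u) + ((u - w) + (w - P w)) := by abel
    have h4 := (normH10_add_le (uh - u) ((u - w) + (w - P w))).trans
      (add_le_add_right (normH10_add_le (u - w) (w - P w)) _)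
    rw [e]
    rw [normH10_sub_comm uh u] at h4
    generalize 2 * κmax / κmin = R at *
    have n5 : 0 ≤ R * h * N := by positivity
    have n6 : 0 ≤ R * δ * N := by positivity
    linarith

end Discretization

/-! ### Comparison of 1/M with the stated rates, and duality. -/

theorem half_le_sqrt_log {M : ℕ} (hM : 2 ≤ M) : 1 / 2 ≤ √(Real.log M) := by
  refine Real.le_sqrt_of_sq_le ?_
  have h1 : Real.log 2 ≤ Real.log M :=
    Real.log_le_log two_pos (by exact_mod_cast hM)
  have := Real.log_two_gt_d9
  linarith

theorem inv_le_sqrt_log_div {M : ℕ} (hM : 2 ≤ M) : 1 / (M : ℝ) ≤ 2 * (√(Real.log M) / M) := by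
  have hM' : (0 : ℝ) < M := by exact_mod_cast (by omega : 0 < M)
  rw [← mul_div_assoc]
  gcongr
  linarith [half_le_sqrt_log hM]

theorem inv_le_inv_sqrt_eigval {M : ℕ} (hM : 2 ≤ M) :
    1 / (M : ℝ) ≤ 9 * (1 / √(eigval (M + 1) (M + 1))) := by
  have hM' : (2 : ℝ) ≤ M := by exact_mod_cast hM
  have hpos : 0 < eigval (M + 1) (M + 1) := by
    rw [eigval]; have := Real.pi_pos; positivity
  have hle : √(eigval (M + 1) (M + 1)) ≤ 9 * M := by
    refine Real.sqrt_le_iff.2 ⟨by positivity, ?_⟩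
    have hpi : Real.pi ^ 2 ≤ 10 := by
      nlinarith [Real.pi_lt_d2, Real.pi_pos]
    rw [eigval]
    push_cast
    calc Real.pi ^ 2 * (((M : ℝ) + 1) ^ 2 + ((M : ℝ) + 1) ^ 2)
        ≤ 10 * (((M : ℝ) + 1) ^ 2 + ((M : ℝ) + 1) ^ 2) := by gcongr
      _ ≤ (9 * (M : ℝ)) ^ 2 := by nlinarith
  rw [mul_one_div, div_le_div_iff₀ (by linarith) (Real.sqrt_pos.2 hpos)]
  linarith

/-- The Aubin-Nitsche duality argument for two nested Galerkin solutions. -/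
theorem IsElliptic.norm_sq_sub_galerkin_le {κ : (Fin 2 → ℝ) → ℝ} {κmin κmax : ℝ}
    (hκ : IsElliptic κ κmin κmax) {f : L2} {Vh W : Submodule ℝ H10} (hW : W ≤ Vh) {uh w zh v : H10}
    (huh : IsGalerkin κ f Vh uh) (hw : IsGalerkin κ f W w)
    (hzh : IsGalerkin κ ((uh - w : H10) : L2) Vh zh) (hv : v ∈ W) :
    ‖((uh - w : H10) : L2)‖ ^ 2 ≤ 2 * κmax * normH10 (zh - v) * normH10 (uh - w) := by
  -- Galerkin orthogonality holds only against the smaller space `W`, so any `v` in `W` may be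
  -- subtracted from the dual solution `zh`.
  have horth : aForm κ v (uh - w) = 0 := by
    rw [aForm_comm, hκ.aForm_sub_left, huh.2 _ (hW hv), hw.2 _ hv, sub_self]
  have e : ‖((uh - w : H10) : L2)‖ ^ 2 = aForm κ (zh - v) (uh - w) := by
    rw [hκ.aForm_sub_left, horth, sub_zero, hzh.2 _ (Vh.sub_mem huh.1 (hW hw.1)), ell_eq_inner,
      real_inner_self_eq_norm_sq]
  rw [e]
  exact (le_abs_self _).trans (hκ.abs_aForm_le _ _)

end LowMode

theorem mainTheorem4 (κ : (Fin 2 → ℝ) → ℝ) (κmin κmax : ℝ)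
    (hκ : LowMode.IsElliptic κ κmin κmax) (C₀ : ℝ) (hC₀ : 0 < C₀) :
    ∃ C : ℝ, 0 < C ∧
      ∀ (h : ℝ), 0 < h →
      ∀ (Vh : Submodule ℝ LowMode.H10), FiniteDimensional ℝ Vh →
      LowMode.FEErrorBound κ Vh h C₀ →
      ∀ (M : ℕ), 2 ≤ M →
      ∀ (P : LowMode.H10 →ₗ[ℝ] Vh),
      LowMode.IsEnergyProjection κ Vh P ∨ LowMode.ApproxProperty M Vh P h C₀ →
      ∀ (f : LowMode.L2) (u uh uRD : LowMode.H10),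
      LowMode.IsWeakSolution κ f u → LowMode.MemH2 u →
      LowMode.IsGalerkin κ f Vh uh →
      LowMode.IsGalerkin κ f (LowMode.VMh M Vh P) uRD →
      LowMode.normH10 (uh - uRD) ≤
          C * (h + √(Real.log M) / M) * LowMode.normH2 u ∧
      (LowMode.H2Regular κ →
        ‖((uh - uRD : LowMode.H10) : LowMode.L2)‖ ≤
          C * (h ^ 2 + 1 / √(LowMode.eigval (M + 1) (M + 1)) * (√(Real.log M) / M)) *
            LowMode.normH2 u) := by
  have hmax := hκ.kmax_pos
  have hmin := hκ.pos
  -- The final constant is fixed before regularity is assumed, so `D` is chosen by cases on whether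
  -- κ is regular, with 0 as a dummy value otherwise.
  obtain ⟨D, hD0, hD⟩ : ∃ D : ℝ, 0 ≤ D ∧ (LowMode.H2Regular κ → ∀ g z,
      LowMode.IsWeakSolution κ g z → LowMode.normH2 z ≤ D * ‖g‖) := by
    by_cases hreg : LowMode.H2Regular κ
    · obtain ⟨D, hD0, hD⟩ := hκ.exists_bound_normH2 hreg
      exact ⟨D, hD0, fun _ => hD⟩
    · exact ⟨0, le_rfl, fun h => absurd h hreg⟩
  obtain ⟨R, hR⟩ : ∃ R, R = 2 * κmax / κmin := ⟨_, rfl⟩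
  obtain ⟨A, hA⟩ : ∃ A, A = 7 * C₀ + 2 + 2 * R := ⟨_, rfl⟩
  have hRpos : 0 < R := by rw [hR]; positivity
  have hApos : 0 < A := by rw [hA]; positivity
  -- The first summand serves the H¹ estimate and the second the L² estimate; adding them yields one
  -- constant for both.
  refine ⟨2 * (R * A) + 36 * (2 * κmax * (A * D) * (R * A)), by positivity, ?_⟩
  intro h hh Vh hfin hFE M hM P hP f u uh uRD hu hu2 huh huRD
  have hM0 : 0 < M := by omega
  have hMpos : (0 : ℝ) < M := by exact_mod_cast hM0
  have hsub : LowMode.VMh M Vh P ≤ Vh := by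
    rintro _ ⟨w, _, rfl⟩
    exact (P w).2
  have hN := LowMode.normH2_nonneg (u : LowMode.L2)
  have hs : 0 ≤ √(Real.log M) / M := by positivity
  obtain ⟨v, hv, hvle⟩ := hκ.exists_mem_VMh_near hC₀ hh hFE hM0 hP hu hu2 huh
  rw [← hR, ← hA] at hvle
  have h1 : LowMode.normH10 (uh - uRD) ≤ R * A * (h + 1 / M) * LowMode.normH2 u := by
    refine (hκ.normH10_sub_galerkin_le hsub huh huRD hv).trans ?_
    rw [← hR]
    refine (mul_le_mul_of_nonneg_left hvle hRpos.le).trans_eq ?_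
    ring
  have hlog := LowMode.inv_le_sqrt_log_div hM
  refine ⟨h1.trans ?_, fun hreg => ?_⟩
  · refine mul_le_mul_of_nonneg_right ?_ hN
    calc R * A * (h + 1 / M) ≤ R * A * (2 * (h + √(Real.log M) / M)) := by gcongr; linarith
      _ = 2 * (R * A) * (h + √(Real.log M) / M) := by ring
      _ ≤ _ := by
        gcongr
        exact le_add_of_nonneg_right (by positivity)
  · obtain ⟨z, hz⟩ := hκ.exists_isWeakSolution ((uh - uRD : LowMode.H10) : LowMode.L2)
    obtain ⟨zh, hzh⟩ := hκ.exists_isGalerkin_of_finiteDimensional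
      ((uh - uRD : LowMode.H10) : LowMode.L2) Vh
    have hz2 := hreg _ z hz
    -- The lemma used for `u` applies unchanged to the dual problem with datum `uh - uRD`, whose
    -- solution is in H² by regularity.
    obtain ⟨y, hy, hyle⟩ := hκ.exists_mem_VMh_near hC₀ hh hFE hM0 hP hz hz2 hzh
    rw [← hR, ← hA] at hyle
    have h2 := hκ.norm_sq_sub_galerkin_le hsub huh huRD hzh hy
    have h3 := hD hreg _ z hz
    have heig := LowMode.inv_le_inv_sqrt_eigval hM
    have hE : (0 : ℝ) ≤ 1 / √(LowMode.eigval (M + 1) (M + 1)) := by positivity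
    have hδ : (0 : ℝ) ≤ 1 / M := by positivity
    have hX := norm_nonneg ((uh - uRD : LowMode.H10) : LowMode.L2)
    have hY := LowMode.normH10_nonneg (uh - uRD)
    have hZ := LowMode.normH10_nonneg (zh - y)
    generalize ‖((uh - uRD : LowMode.H10) : LowMode.L2)‖ = X at *
    generalize LowMode.normH10 (uh - uRD) = Y at *
    generalize LowMode.normH10 (zh - y) = Z at *
    generalize LowMode.normH2 (u : LowMode.L2) = N at *
    generalize √(Real.log M) / M = s at *
    generalize 1 / √(LowMode.eigval (M + 1) (M + 1)) = E at *
    generalize (1 : ℝ) / M = δ at *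
    have hδ2 : δ ^ 2 ≤ 18 * (E * s) := by
      calc δ ^ 2 = δ * δ := sq δ
        _ ≤ (9 * E) * (2 * s) := mul_le_mul heig hlog hδ (by positivity)
        _ = 18 * (E * s) := by ring
    -- (h + δ)² ≤ 2h² + 2δ², and δ² ≤ 18·E·s.
    have hsq : (h + δ) ^ 2 ≤ 36 * (h ^ 2 + E * s) := by
      nlinarith [sq_nonneg (h - δ), sq_nonneg h]
    have hZ' : Z ≤ A * (h + δ) * (D * X) := hyle.trans (by gcongr)
    have h4 : X ^ 2 ≤ (2 * κmax * (A * D) * (R * A)) * (h + δ) ^ 2 * N * X := by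
      calc X ^ 2 ≤ 2 * κmax * Z * Y := h2
        _ ≤ 2 * κmax * (A * (h + δ) * (D * X)) * (R * A * (h + δ) * N) := by gcongr
        _ = _ := by ring
    have h5 : X ≤ (2 * κmax * (A * D) * (R * A)) * (h + δ) ^ 2 * N := by
      rcases hX.eq_or_lt with h0 | h0
      · rw [← h0]; positivity
      · refine le_of_mul_le_mul_right ?_ h0
        rw [← sq]; exact h4
    refine h5.trans (mul_le_mul_of_nonneg_right ?_ hN)
    calc (2 * κmax * (A * D) * (R * A)) * (h + δ) ^ 2
        ≤ (2 * κmax * (A * D) * (R * A)) * (36 * (h ^ 2 + E * s)) := by gcongr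
      _ = 36 * (2 * κmax * (A * D) * (R * A)) * (h ^ 2 + E * s) := by ring
      _ ≤ _ := by
        gcongr
        exact le_add_of_nonneg_left (by positivity)

end
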